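/- Let $\mathbb{H}$ be the quaternions with modulus $|\cdot|$. For $a,z\in\mathbb{H}^d$ write $a^*z=\sum_j \overline{a_j}z_j$ and $\|z\|=(\sum_j|z_j|^2)^{1/2}$; let ${\rm sign}(w)=w/|w|$ for $0\ne w\in\mathbb{H}$ and ${\rm sign}(0)=1$. For $x,z\in\mathbb{H}^d$ put $$\phi(z)={\rm sign}(x^*z),\qquad {\rm dist}(z,x)=\min_{w\in\mathbb{H},\,|w|=1}\|z-xw\| .$$ Given measurement vectors $\alpha_1,\dots,\alpha_n\in\mathbb{H}^d$, a signal $x\in\mathbb{H}^d$ and a control parameter $\sigma>0$, let $\psi_k=|\alpha_k^*x|$, $\varepsilon_k=\sqrt{\sigma}\,\psi_k$, $$f_\varepsilon(z)=\frac1n\sum_{k=1}^n\Big(\sqrt{|\alpha_k^*z|^2+\varepsilon_k^2}-\sqrt{\psi_k^2+\varepsilon_k^2}\Big)^2,$$ $$\nabla f_\varepsilon(z)=\frac1n\sum_{k=1}^n\Big(1-\frac{\sqrt{\psi_k^2+\varepsilon_k^2}}{\sqrt{|\alpha_k^*z|^2+\varepsilon_k^2}}\Big)\alpha_k\alpha_k^*z$$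 (a summand with $\psi_k=0$ is read as $\alpha_k\alpha_k^*z$). The Quaternionic Perturbed Amplitude Flow (QPAF) with weighting parameter $\gamma\in\mathbb{R}$ and step size $\eta>0$ is as follows. Put $\lambda_0=\big(\frac1n\sum_k\psi_k^2\big)^{1/2}$, let $\nu$ be a normalized eigenvector for the largest standard (right) eigenvalue of the Hermitian matrix $S_{\rm in}=\frac1n\sum_k\big(\gamma-e^{-\psi_k^2/\lambda_0^2}\big)\alpha_k\alpha_k^*$, and set $z_0=\lambda_0\nu$, $z_{t+1}=z_t-\eta\,\nabla f_\varepsilon(z_t)$ for $t\ge 0$. (A standard eigenvalue is $q=a+bi$ with $a\in\mathbb{R}$, $b\ge0$ and $Sv=vq$ for some $v\neq0$; those of a Hermitian matrix are real.) **Theorem.** Let $\sigma>0$ and $\gamma\in\mathbb{R}$. (a) For all $\alpha_1,\dots,\alpha_n,x\in\mathbb{H}^d$, the function $f_\varepsilon$ is (real) differentiable everywhere on $\mathbb{H}^d$, and $\nabla f_\varepsilon$ as displayed above equals twice the generalized $\mathbb{HR}$ gradient of $f_\varepsilon$, whose $l$-th entry at $q$ is $\frac14\big(\partial_{q_{l,a}}f_\varepsilon+i\,\partial_{q_{l,b}}f_\varepsilon+j\,\partial_{q_{l,c}}f_\varepsilon+k\,\partial_{q_{l,d}}f_\varepsilon\big)$,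 where $q_l=q_{l,a}+q_{l,b}i+q_{l,c}j+q_{l,d}k$. (b) There are constants $C,c_1,c_2,\mu,\lambda>0$ with $\lambda\mu<1$, and $0<\rho<1$, depending only on $\sigma$ and $\gamma$, such that the following holds for all $d,n\in\mathbb{N}$ with $n\ge Cd$ and every nonzero $x\in\mathbb{H}^d$. Let the entries of $\alpha_1,\dots,\alpha_n$ be i.i.d. quaternionic Gaussian, with law $\frac12\big(\mathcal{N}(0,1)+\mathcal{N}(0,1)i+\mathcal{N}(0,1)j+\mathcal{N}(0,1)k\big)$ (independent components). Then with probability at least $1-c_1e^{-c_2n}$ all of the following hold: 1. (local regularity condition ${\rm LRC}(\mu,\lambda,\rho)$) for all $z\in\mathbb{H}^d$ with $\|z-x\phi(z)\|\le\rho\|x\|$, $${\rm Re}\big(\nabla f_\varepsilon(z)^*(z-x\phi(z))\big)\ \ge\ \frac{\lambda}{2}\,{\rm dist}^2(z,x)+\frac{\mu}{2}\,\|\nabla f_\varepsilon(z)\|^2;$$ 2. the spectral initial guess exists and lies in this region: a vector $\nu$ as above exists, and for every such $\nu$, ${\rm dist}(z_0,x)\le\rho\|x\|$; 3. (linear convergence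 up to a right quaternion phase) for every such $\nu$, every step size $0<\eta\le\mu$ and every $t\ge0$, $${\rm dist}^2(z_t,x)\le(1-\lambda\eta)^t\,{\rm dist}^2(z_0,x).$$ -/

import Mathlib

open scoped Quaternion BigOperators
open MeasureTheory ProbabilityTheory

noncomputable section

namespace QPAF

/-- `ℍ^d` with the norm `‖q‖ = (∑ |q_j|²)^{1/2}`. -/
abbrev QVec (d : ℕ) : Type := PiLp 2 (fun _ : Fin d => ℍ[ℝ])

/-- The quaternionic inner product `⟨a, z⟩ = a^* z`. -/
def qInner {d : ℕ} (a z : QVec d) : ℍ[ℝ] := ∑ j, star (a j) * z j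

/-- Right multiplication `x w` of a vector by a quaternion. -/
def rightMul {d : ℕ} (x : QVec d) (w : ℍ[ℝ]) : QVec d :=
  WithLp.toLp 2 fun j => x j * w

/-- `sign w = w / |w|` for `w ≠ 0`, and `sign 0 = 1`. -/
def qSign (w : ℍ[ℝ]) : ℍ[ℝ] :=
  open Classical in if w = 0 then 1 else ‖w‖⁻¹ • w

/-- Distance up to a right quaternion phase: the minimum over `|w| = 1` of `‖z - x w‖`. -/
def phaseDist {d : ℕ} (z x : QVec d) : ℝ :=
  ⨅ w : {w : ℍ[ℝ] // ‖w‖ = 1}, ‖z - rightMul x w.1‖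

/-- The phase `φ(z) = sign (x^* z)` of `z` relative to `x`. -/
def phase {d : ℕ} (x z : QVec d) : ℍ[ℝ] := qSign (qInner x z)

/-- The local regularity condition `LRC(μ, lam, ρ)` of a vector field `G` around `x`. -/
def LRC {d : ℕ} (G : QVec d → QVec d) (x : QVec d) (μ lam ρ : ℝ) : Prop :=
  ∀ z : QVec d, ‖z - rightMul x (phase x z)‖ ≤ ρ * ‖x‖ →
    lam / 2 * phaseDist z x ^ 2 + μ / 2 * ‖G z‖ ^ 2
      ≤ (qInner (G z) (z - rightMul x (phase x z))).re

/-- The phaseless data `ψ_k = |α_k^* x|`. -/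
def amplitudes {d n : ℕ} (A : Fin n → QVec d) (x : QVec d) : Fin n → ℝ :=
  fun k => ‖qInner (A k) x‖

/-- The perturbation vector `ε = √σ ψ`. -/
def perturbation {n : ℕ} (σ : ℝ) (ψ : Fin n → ℝ) : Fin n → ℝ := fun k => √σ * ψ k

/-- The perturbed amplitude objective `f_ε`. -/
def loss {d n : ℕ} (A : Fin n → QVec d) (ψ ε : Fin n → ℝ) (z : QVec d) : ℝ :=
  (1 / (n : ℝ)) * ∑ k, (√(‖qInner (A k) z‖ ^ 2 + ε k ^ 2) - √(ψ k ^ 2 + ε k ^ 2)) ^ 2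

/-- The imaginary unit `i`. -/
def unitI : ℍ[ℝ] := ⟨0, 1, 0, 0⟩

/-- The imaginary unit `j`. -/
def unitJ : ℍ[ℝ] := ⟨0, 0, 1, 0⟩

/-- The imaginary unit `k`. -/
def unitK : ℍ[ℝ] := ⟨0, 0, 0, 1⟩

/-- The partial derivative of `f` at `z` along the real coordinate `u ∈ {1, i, j, k}` of the
`l`-th quaternionic entry. -/
def partialDeriv {d : ℕ} (f : QVec d → ℝ) (z : QVec d) (l : Fin d) (u : ℍ[ℝ]) : ℝ :=
  lineDeriv ℝ f z (WithLp.toLp 2 (Pi.single l u))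

/-- The left generalized `ℍℝ` derivative with respect to the `l`-th entry. -/
def ghrDeriv {d : ℕ} (f : QVec d → ℝ) (z : QVec d) (l : Fin d) : ℍ[ℝ] :=
  (1 / 4 : ℝ) • (partialDeriv f z l 1 • (1 : ℍ[ℝ]) - partialDeriv f z l unitI • unitI
    - partialDeriv f z l unitJ • unitJ - partialDeriv f z l unitK • unitK)

/-- The generalized `ℍℝ` gradient: the conjugate transpose of the row of derivatives. -/
def ghrGradient {d : ℕ} (f : QVec d → ℝ) (z : QVec d) : QVec d :=
  WithLp.toLp 2 fun l => star (ghrDeriv f z l)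

/-- The search direction `∇f_ε(z)` used by the algorithm,
`(1/n) ∑ (1 - √(ψ_k² + ε_k²) / √(|α_k^* z|² + ε_k²)) α_k α_k^* z`. -/
def gradient {d n : ℕ} (A : Fin n → QVec d) (ψ ε : Fin n → ℝ) (z : QVec d) : QVec d :=
  (1 / (n : ℝ)) • ∑ k,
    (1 - √(ψ k ^ 2 + ε k ^ 2) / √(‖qInner (A k) z‖ ^ 2 + ε k ^ 2)) •
      rightMul (A k) (qInner (A k) z)

/-- The norm estimate `λ₀ = ((1/n) ∑ ψ_k²)^{1/2}`. -/
def normEstimate {n : ℕ} (ψ : Fin n → ℝ) : ℝ := √((1 / (n : ℝ)) * ∑ k, ψ k ^ 2)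

/-- The initialization matrix `S_in = (1/n) ∑ (γ - exp(-ψ_k²/λ₀²)) α_k α_k^*`. -/
def initMatrix {d n : ℕ} (A : Fin n → QVec d) (ψ : Fin n → ℝ) (γ : ℝ) :
    Matrix (Fin d) (Fin d) ℍ[ℝ] :=
  fun i j => (1 / (n : ℝ)) • ∑ k,
    (γ - Real.exp (-(ψ k ^ 2 / normEstimate ψ ^ 2))) • (A k i * star (A k j))

/-- `S v = v q` with `v ≠ 0`: `q` is a right eigenvalue with eigenvector `v`. -/
def IsRightEigenpair {d : ℕ} (S : Matrix (Fin d) (Fin d) ℍ[ℝ]) (q : ℍ[ℝ]) (v : QVec d) : Prop :=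
  v ≠ 0 ∧ ∀ i, ∑ j, S i j * v j = v i * q

/-- Standard eigenvalues are the right eigenvalues of the form `a + b i` with `b ≥ 0`. -/
def IsStandardEigenvalue {d : ℕ} (S : Matrix (Fin d) (Fin d) ℍ[ℝ]) (q : ℍ[ℝ]) : Prop :=
  (∃ v, IsRightEigenpair S q v) ∧ 0 ≤ q.imI ∧ q.imJ = 0 ∧ q.imK = 0

/-- `v` is a normalized eigenvector for the largest standard eigenvalue of the (Hermitian)
matrix `S`; the standard eigenvalues of a Hermitian matrix are real. -/
def IsLeadingEigenvector {d : ℕ} (S : Matrix (Fin d) (Fin d) ℍ[ℝ]) (v : QVec d) : Prop :=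
  ‖v‖ = 1 ∧ ∃ m : ℝ, IsRightEigenpair S (m : ℍ[ℝ]) v ∧
    ∀ q : ℍ[ℝ], IsStandardEigenvalue S q → q.re ≤ m

/-- The QPAF iteration `z_{t+1} = z_t - η ∇f_ε(z_t)` with `ε = √σ ψ`, started at `z0`. -/
def iterates {d n : ℕ} (A : Fin n → QVec d) (ψ : Fin n → ℝ) (σ η : ℝ) (z0 : QVec d) :
    ℕ → QVec d
  | 0 => z0
  | t + 1 => iterates A ψ σ η z0 t
      - η • gradient A ψ (perturbation σ ψ) (iterates A ψ σ η z0 t)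

/-- The four real coordinates of a quaternion. -/
def coords (q : ℍ[ℝ]) : Fin 4 → ℝ := ![q.re, q.imI, q.imJ, q.imK]

/-- The entries of the random vectors `α_k` are i.i.d. with law
`½ (N(0,1) + N(0,1) i + N(0,1) j + N(0,1) k)`: all real coordinates of all entries are
independent, each with law `½ N(0,1) = N(0, 1/4)`. -/
structure IsQuaternionGaussian {Ω : Type*} [MeasurableSpace Ω] {d n : ℕ} (P : Measure Ω)
    (α : Fin n → Ω → QVec d) : Prop where
  law : ∀ k j c, HasLaw (fun ω => coords (α k ω j) c) (gaussianReal 0 (1 / 4)) P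
  indep : iIndepFun (fun (p : Fin n × Fin d × Fin 4) ω => coords (α p.1 ω p.2.1) p.2.2) P

end QPAF

end

/-!
The weights `e^{-ψ_k²/λ_0²}` and the summands of `∇f_ε` see the measurement vectors only through
quadratic forms `h ↦ (1/n) ∑ G(α_k, h)²`, with `G` Lipschitz in `h` for the seminorm `|α_k^* h|`.
Each such form concentrates around its expectation at a point of the unit sphere by a Chernoff
bound, and uniformly on the sphere by a net of size `e^{O(d)}`, affordable once `n ≥ C d`.

Local regularity: after right multiplication of `x` by the phase `φ(z)`, the error `h = z - x φ(z)`
has `x^* h` real. To first order the gradient form is a multiple of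
`(1/n) ∑ (Re(conj(α_k^* x) α_k^* h) / |α_k^* x|)²`, whose expectation is bounded below on such `h`.
The first order is a good approximation for the `k` with `|α_k^* h| ≤ δ |α_k^* x|`; for small
`h` the other `k` have `|α_k^* x|` very small or `|α_k^* h|` very large and contribute little.
The contraction of the iteration follows from the regularity by expanding a square.

Initialization: for a quaternionic Gaussian variable `q` the expectation of `S_in` has two
eigenvalues, the one at `x` exceeding the one on its orthogonal complement by
`𝔼 (e^{-|q|²} (1 - |q|²)) > 0`. A leading eigenvector of `S_in` is therefore almost parallel to `x`.
-/

noncomputable section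

namespace QPAF

/-! ### The quaternionic inner product -/

section InnerProduct

variable {d : ℕ}

theorem inner_eq_re_star_mul (p q : ℍ[ℝ]) : inner ℝ p q = (star p * q).re := by
  simp only [Quaternion.inner_def, Quaternion.re_mul, Quaternion.re_star, Quaternion.imI_star,
    Quaternion.imJ_star, Quaternion.imK_star]
  ring

theorem re_qInner (a z : QVec d) : (qInner a z).re = inner ℝ a z := by
  rw [PiLp.inner_apply, qInner]
  exact (map_sum (QuaternionAlgebra.reₗ (-1 : ℝ) 0 (-1)) _ _).trans
    (Finset.sum_congr rfl fun j _ => (inner_eq_re_star_mul _ _).symm)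

theorem qInner_add_right (a y z : QVec d) : qInner a (y + z) = qInner a y + qInner a z := by
  simp [qInner, mul_add, Finset.sum_add_distrib]

theorem qInner_smul_right (a z : QVec d) (r : ℝ) : qInner a (r • z) = r • qInner a z := by
  simp [qInner, Finset.smul_sum]

theorem qInner_add_left (y z a : QVec d) : qInner (y + z) a = qInner y a + qInner z a := by
  simp [qInner, add_mul, Finset.sum_add_distrib]

theorem qInner_smul_left (a z : QVec d) (r : ℝ) : qInner (r • a) z = r • qInner a z := by
  simp [qInner, Finset.smul_sum]

theorem qInner_rightMul_right (a z : QVec d) (w : ℍ[ℝ]) :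
    qInner a (rightMul z w) = qInner a z * w := by
  simp [qInner, rightMul, Finset.sum_mul, mul_assoc]

theorem qInner_rightMul_left (a z : QVec d) (w : ℍ[ℝ]) :
    qInner (rightMul a w) z = star w * qInner a z := by
  simp [qInner, rightMul, Finset.mul_sum, mul_assoc]

theorem real_inner_rightMul_left (a z : QVec d) (w : ℍ[ℝ]) :
    inner ℝ (rightMul a w) z = inner ℝ w (qInner a z) := by
  rw [← re_qInner, qInner_rightMul_left, inner_eq_re_star_mul]

theorem qInner_self (z : QVec d) : qInner z z = ((‖z‖ ^ 2 : ℝ) : ℍ[ℝ]) := by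
  have entry (j : Fin d) : star (z j) * z j = ((‖z j‖ ^ 2 : ℝ) : ℍ[ℝ]) := by
    rw [Quaternion.star_mul_self, Quaternion.normSq_eq_norm_mul_self, sq]
  rw [PiLp.norm_sq_eq_of_L2, qInner]
  exact (Finset.sum_congr rfl fun j _ => entry j).trans (map_sum (algebraMap ℝ ℍ[ℝ]) _ _).symm

theorem norm_rightMul (x : QVec d) (w : ℍ[ℝ]) : ‖rightMul x w‖ = ‖x‖ * ‖w‖ := by
  refine (pow_left_inj₀ (norm_nonneg _) (by positivity) two_ne_zero).1 ?_
  simp [PiLp.norm_sq_eq_of_L2, rightMul, mul_pow, Finset.sum_mul]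

theorem norm_qInner_le (a z : QVec d) : ‖qInner a z‖ ≤ ‖a‖ * ‖z‖ := by
  have h : ‖qInner a z‖ * ‖qInner a z‖ ≤ ‖a‖ * ‖z‖ * ‖qInner a z‖ :=
    calc ‖qInner a z‖ * ‖qInner a z‖ = inner ℝ z (rightMul a (qInner a z)) := by
          rw [real_inner_comm, real_inner_rightMul_left, real_inner_self_eq_norm_mul_norm]
      _ ≤ ‖z‖ * ‖rightMul a (qInner a z)‖ := real_inner_le_norm _ _
      _ = ‖a‖ * ‖z‖ * ‖qInner a z‖ := by rw [norm_rightMul]; ring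
  rcases (norm_nonneg (qInner a z)).eq_or_lt with h0 | h0
  · rw [← h0]; positivity
  · exact le_of_mul_le_mul_right h h0

/-- The quaternionic inner product `a^* z` as a continuous real bilinear map. -/
def qInnerL (d : ℕ) : QVec d →L[ℝ] QVec d →L[ℝ] ℍ[ℝ] :=
  LinearMap.mkContinuous₂
    (LinearMap.mk₂ ℝ qInner qInner_add_left (fun r a z => qInner_smul_left a z r) qInner_add_right
      fun r a z => qInner_smul_right a z r)
    1 fun a z => (norm_qInner_le a z).trans_eq (by rw [one_mul])

theorem qInnerL_apply (a z : QVec d) : qInnerL d a z = qInner a z := rfl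

theorem qInner_zero_right (a : QVec d) : qInner a 0 = 0 := map_zero (qInnerL d a)

theorem qInner_sub_right (a y z : QVec d) : qInner a (y - z) = qInner a y - qInner a z :=
  map_sub (qInnerL d a) y z

end InnerProduct

/-! ### The distance up to a phase -/

section PhaseDist

variable {d : ℕ}

theorem norm_qSign (w : ℍ[ℝ]) : ‖qSign w‖ = 1 := by
  unfold qSign
  split_ifs with h
  · exact norm_one
  · rw [norm_smul, norm_inv, norm_norm, inv_mul_cancel₀ (norm_ne_zero_iff.2 h)]

theorem inner_qSign_left (w : ℍ[ℝ]) : inner ℝ (qSign w) w = ‖w‖ := by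
  unfold qSign
  split_ifs with h
  · simp [h]
  · rw [real_inner_smul_left, real_inner_self_eq_norm_mul_norm,
      inv_mul_cancel_left₀ (norm_ne_zero_iff.2 h)]

theorem star_qSign_mul (w : ℍ[ℝ]) : star (qSign w) * w = (‖w‖ : ℍ[ℝ]) := by
  unfold qSign
  split_ifs with h
  · simp [h]
  · rw [Quaternion.star_smul, smul_mul_assoc, Quaternion.star_mul_self,
      Quaternion.normSq_eq_norm_mul_self, ← Quaternion.coe_smul, smul_eq_mul,
      inv_mul_cancel_left₀ (norm_ne_zero_iff.2 h)]

theorem norm_phase (x z : QVec d) : ‖phase x z‖ = 1 := norm_qSign _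

theorem norm_sub_rightMul_sq (z x : QVec d) {w : ℍ[ℝ]} (hw : ‖w‖ = 1) :
    ‖z - rightMul x w‖ ^ 2 = ‖z‖ ^ 2 + ‖x‖ ^ 2 - 2 * inner ℝ w (qInner x z) := by
  rw [norm_sub_sq_real, norm_rightMul, hw, real_inner_comm, real_inner_rightMul_left]
  ring

theorem phaseDist_le (z x : QVec d) {w : ℍ[ℝ]} (hw : ‖w‖ = 1) :
    phaseDist z x ≤ ‖z - rightMul x w‖ :=
  ciInf_le (f := fun w : {w : ℍ[ℝ] // ‖w‖ = 1} => ‖z - rightMul x w.1‖)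
    ⟨0, by rintro _ ⟨w, rfl⟩; exact norm_nonneg _⟩ ⟨w, hw⟩

theorem phaseDist_eq_norm_sub_phase (z x : QVec d) :
    phaseDist z x = ‖z - rightMul x (phase x z)‖ := by
  refine (phaseDist_le z x (norm_phase x z)).antisymm ?_
  have : Nonempty {w : ℍ[ℝ] // ‖w‖ = 1} := ⟨⟨1, norm_one⟩⟩
  refine le_ciInf fun ⟨w, hw⟩ => ?_
  refine (pow_le_pow_iff_left₀ (norm_nonneg _) (norm_nonneg _) two_ne_zero).1 ?_
  rw [norm_sub_rightMul_sq z x hw, norm_sub_rightMul_sq z x (norm_phase x z), phase,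
    inner_qSign_left]
  have := real_inner_le_norm w (qInner x z)
  rw [hw, one_mul] at this
  linarith

theorem phaseDist_nonneg (z x : QVec d) : 0 ≤ phaseDist z x :=
  Real.iInf_nonneg fun _ => norm_nonneg _

theorem phaseDist_sq (z x : QVec d) :
    phaseDist z x ^ 2 = ‖z‖ ^ 2 + ‖x‖ ^ 2 - 2 * ‖qInner x z‖ := by
  rw [phaseDist_eq_norm_sub_phase, norm_sub_rightMul_sq z x (norm_phase x z), phase,
    inner_qSign_left]

end PhaseDist

/-! ### Linear convergence from local regularity -/

section Convergence

variable {d n : ℕ} {x : QVec d} {μ lam ρ η : ℝ}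

theorem LRC.phaseDist_step_sq_le {G : QVec d → QVec d} (hG : LRC G x μ lam ρ) (hη : 0 < η)
    (hημ : η ≤ μ) {z : QVec d} (hz : phaseDist z x ≤ ρ * ‖x‖) :
    phaseDist (z - η • G z) x ^ 2 ≤ (1 - lam * η) * phaseDist z x ^ 2 := by
  set e := z - rightMul x (phase x z) with he
  have hze : phaseDist z x = ‖e‖ := phaseDist_eq_norm_sub_phase z x
  have regular : lam / 2 * ‖e‖ ^ 2 + μ / 2 * ‖G z‖ ^ 2 ≤ inner ℝ (G z) e := by
    rw [← re_qInner, ← hze]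
    exact hG z (hze ▸ hz)
  have step : phaseDist (z - η • G z) x ≤ ‖e - η • G z‖ := by
    rw [he, sub_right_comm]
    exact phaseDist_le _ x (norm_phase x z)
  calc phaseDist (z - η • G z) x ^ 2 ≤ ‖e - η • G z‖ ^ 2 :=
        pow_le_pow_left₀ (phaseDist_nonneg _ _) step 2
    _ = ‖e‖ ^ 2 - 2 * η * inner ℝ (G z) e + η ^ 2 * ‖G z‖ ^ 2 := by
        rw [norm_sub_sq_real, inner_smul_right, real_inner_comm, norm_smul, mul_pow,
          Real.norm_eq_abs, sq_abs]
        ring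
    _ ≤ ‖e‖ ^ 2 - 2 * η * (lam / 2 * ‖e‖ ^ 2 + μ / 2 * ‖G z‖ ^ 2) + η * μ * ‖G z‖ ^ 2 := by
        rw [sq η]
        gcongr
    _ = (1 - lam * η) * phaseDist z x ^ 2 := by rw [hze]; ring

theorem LRC.phaseDist_iterates_sq_le {A : Fin n → QVec d} {ψ : Fin n → ℝ} {σ : ℝ}
    (hG : LRC (gradient A ψ (perturbation σ ψ)) x μ lam ρ) (hlam : 0 < lam) (hlm : lam * μ < 1)
    (hη : 0 < η) (hημ : η ≤ μ) {z₀ : QVec d} (hz : phaseDist z₀ x ≤ ρ * ‖x‖) (t : ℕ) :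
    phaseDist (iterates A ψ σ η z₀ t) x ^ 2 ≤ (1 - lam * η) ^ t * phaseDist z₀ x ^ 2 := by
  have rate_nonneg : 0 ≤ 1 - lam * η := by nlinarith
  have rate_le_one : 1 - lam * η ≤ 1 := by nlinarith
  induction t with
  | zero => simp [iterates]
  | succ t ih =>
    have stays : phaseDist (iterates A ψ σ η z₀ t) x ≤ phaseDist z₀ x := by
      refine (pow_le_pow_iff_left₀ (phaseDist_nonneg _ _) (phaseDist_nonneg _ _) two_ne_zero).1 ?_
      exact ih.trans (mul_le_of_le_one_left (sq_nonneg _) (pow_le_one₀ rate_nonneg rate_le_one))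
    calc phaseDist (iterates A ψ σ η z₀ (t + 1)) x ^ 2
        ≤ (1 - lam * η) * phaseDist (iterates A ψ σ η z₀ t) x ^ 2 :=
          hG.phaseDist_step_sq_le hη hημ (stays.trans hz)
      _ ≤ (1 - lam * η) * ((1 - lam * η) ^ t * phaseDist z₀ x ^ 2) := by gcongr
      _ = (1 - lam * η) ^ (t + 1) * phaseDist z₀ x ^ 2 := by ring

end Convergence

/-! ### Weighted Gram operators and the search direction -/

section WeightedGram

open ContinuousLinearMap (adjoint)

variable {d n : ℕ}

theorem one_div_mul_sum_eq_expect (f : Fin n → ℝ) : (1 / (n : ℝ)) * ∑ k, f k = 𝔼 k, f k := by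
  rw [Fintype.expect_eq_sum_div_card, Fintype.card_fin, one_div_mul_eq_div]

theorem adjoint_qInnerL_apply (a : QVec d) (w : ℍ[ℝ]) :
    adjoint (qInnerL d a) w = rightMul a w :=
  ext_inner_right ℝ fun z => by
    rw [ContinuousLinearMap.adjoint_inner_left, real_inner_rightMul_left, qInnerL_apply]

/-- The real linear operator `(1/n) ∑ w_k α_k α_k^*` on `ℍ^d`. The search direction and the
initialization matrix of the algorithm are both of this form. -/
def weightedGram (A : Fin n → QVec d) (w : Fin n → ℝ) : QVec d →L[ℝ] QVec d :=
  (1 / (n : ℝ)) • ∑ k, w k • (adjoint (qInnerL d (A k))).comp (qInnerL d (A k))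

theorem weightedGram_apply (A : Fin n → QVec d) (w : Fin n → ℝ) (z : QVec d) :
    weightedGram A w z = (1 / (n : ℝ)) • ∑ k, w k • rightMul (A k) (qInner (A k) z) := by
  simp only [weightedGram, smul_apply, sum_apply, ContinuousLinearMap.comp_apply,
    adjoint_qInnerL_apply, qInnerL_apply]

theorem inner_weightedGram_left (A : Fin n → QVec d) (w : Fin n → ℝ) (y z : QVec d) :
    inner ℝ (weightedGram A w y) z =
      𝔼 k, w k * inner ℝ (qInner (A k) y) (qInner (A k) z) := by
  simp only [weightedGram_apply, real_inner_smul_left, sum_inner, real_inner_rightMul_left,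
    one_div_mul_sum_eq_expect]

theorem gradient_eq_weightedGram (A : Fin n → QVec d) (ψ ε : Fin n → ℝ) (z : QVec d) :
    gradient A ψ ε z = weightedGram A
      (fun k => 1 - √(ψ k ^ 2 + ε k ^ 2) / √(‖qInner (A k) z‖ ^ 2 + ε k ^ 2)) z :=
  (weightedGram_apply A _ z).symm

theorem hasFDerivAt_sqrt_norm_sq_add_sub_sq {E F : Type*} [NormedAddCommGroup E]
    [NormedSpace ℝ E] [NormedAddCommGroup F] [InnerProductSpace ℝ F] (L : E →L[ℝ] F) {e c : ℝ}
    (h : e = 0 → c = 0) (z : E) :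
    HasFDerivAt (fun z => (√(‖L z‖ ^ 2 + e ^ 2) - c) ^ 2)
      ((2 * (1 - c / √(‖L z‖ ^ 2 + e ^ 2))) • (innerSL ℝ (L z)).comp L) z := by
  have norm_sq : HasFDerivAt (fun z => ‖L z‖ ^ 2) ((2 : ℝ) • (innerSL ℝ (L z)).comp L) z := by
    simpa [two_smul] using (L.hasFDerivAt (x := z)).norm_sq
  by_cases he : e = 0
  · simpa [he, h he, Real.sqrt_sq (norm_nonneg _)] using norm_sq
  · have hpos : 0 < ‖L z‖ ^ 2 + e ^ 2 := by positivity
    refine ((((norm_sq.add_const (e ^ 2)).sqrt hpos.ne').sub_const c).pow 2).congr_fderiv ?_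
    have := (Real.sqrt_pos.2 hpos).ne'
    rw [smul_smul, smul_smul]
    congr 1
    simp only [Nat.add_one_sub_one, pow_one, nsmul_eq_mul, Nat.cast_ofNat]
    field_simp

theorem hasFDerivAt_loss (A : Fin n → QVec d) {ψ ε : Fin n → ℝ}
    (h : ∀ k, ε k = 0 → ψ k = 0) (z : QVec d) :
    HasFDerivAt (loss A ψ ε) ((2 : ℝ) • innerSL ℝ (gradient A ψ ε z)) z := by
  have summand (k : Fin n) := hasFDerivAt_sqrt_norm_sq_add_sub_sq (qInnerL d (A k))
    (e := ε k) (c := √(ψ k ^ 2 + ε k ^ 2)) (fun h0 => by simp [h0, h k h0]) z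
  refine ((HasFDerivAt.fun_sum fun k _ => summand k).const_mul (1 / (n : ℝ))).congr_fderiv ?_
  ext y
  simp only [smul_apply, sum_apply, ContinuousLinearMap.comp_apply, innerSL_apply_apply,
    qInnerL_apply, smul_eq_mul, gradient_eq_weightedGram, inner_weightedGram_left,
    one_div_mul_sum_eq_expect, Finset.mul_expect, mul_assoc]

theorem partialDeriv_loss (A : Fin n → QVec d) {ψ ε : Fin n → ℝ} (h : ∀ k, ε k = 0 → ψ k = 0)
    (z : QVec d) (l : Fin d) (u : ℍ[ℝ]) :
    partialDeriv (loss A ψ ε) z l u = 2 * inner ℝ (gradient A ψ ε z l) u := by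
  rw [partialDeriv, ((hasFDerivAt_loss A h z).hasLineDerivAt _).lineDeriv, smul_apply,
    innerSL_apply_apply, smul_eq_mul, PiLp.inner_apply,
    Finset.sum_eq_single_of_mem l (Finset.mem_univ l) fun j _ hj => by simp [hj]]
  simp

theorem gradient_eq_two_smul_ghrGradient (A : Fin n → QVec d) {ψ ε : Fin n → ℝ}
    (h : ∀ k, ε k = 0 → ψ k = 0) (z : QVec d) :
    gradient A ψ ε z = (2 : ℝ) • ghrGradient (loss A ψ ε) z := by
  refine PiLp.ext fun l => ?_
  simp only [ghrGradient, ghrDeriv, partialDeriv_loss A h, PiLp.smul_apply]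
  ext <;> simp [Quaternion.inner_def] <;> simp only [unitI, unitJ, unitK] <;> ring

theorem eq_zero_of_perturbation_eq_zero {σ : ℝ} (hσ : 0 < σ) (ψ : Fin n → ℝ) (k : Fin n)
    (h : perturbation σ ψ k = 0) : ψ k = 0 :=
  (mul_eq_zero.1 h).resolve_left (Real.sqrt_pos.2 hσ).ne'

end WeightedGram

/-! ### Local regularity -/

section Weight

variable {E : Type*} [NormedAddCommGroup E]

/-- The weight of the `k`-th summand of the search direction at `z`, in terms of `u = α_k^* x`
and `w = α_k^* z`. -/
def weight (σ : ℝ) (u w : E) : ℝ :=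
  1 - √(‖u‖ ^ 2 + (√σ * ‖u‖) ^ 2) / √(‖w‖ ^ 2 + (√σ * ‖u‖) ^ 2)

theorem abs_sqrt_sq_add_sq_sub_le (a b e : ℝ) :
    |√(a ^ 2 + e ^ 2) - √(b ^ 2 + e ^ 2)| ≤ |a - b| := by
  rw [← Complex.norm_add_mul_I, ← Complex.norm_add_mul_I, ← Real.norm_eq_abs (a - b),
    ← Complex.norm_real (a - b), Complex.ofReal_sub,
    ← add_sub_add_right_eq_sub (a : ℂ) b (e * Complex.I)]
  exact abs_norm_sub_norm_le _ _

theorem abs_weight_mul_norm_le (σ : ℝ) (u w : E) : |weight σ u w| * ‖w‖ ≤ ‖w - u‖ := by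
  have num_le := (abs_sqrt_sq_add_sq_sub_le ‖w‖ ‖u‖ (√σ * ‖u‖)).trans (abs_norm_sub_norm_le w u)
  unfold weight
  set b := √(‖w‖ ^ 2 + (√σ * ‖u‖) ^ 2)
  have norm_le : ‖w‖ ≤ b := Real.le_sqrt_of_sq_le (by linarith [sq_nonneg (√σ * ‖u‖)])
  rcases (Real.sqrt_nonneg _ : 0 ≤ b).eq_or_lt with h0 | h0
  · rw [(norm_le.trans h0.symm.le).antisymm (norm_nonneg w), mul_zero]
    exact norm_nonneg _
  · rw [one_sub_div h0.ne', abs_div, abs_of_pos h0, div_mul_eq_mul_div, div_le_iff₀ h0]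
    gcongr

variable [InnerProductSpace ℝ E] {σ δ : ℝ}

theorem abs_weight_mul_inner_le (σ : ℝ) (u w v : E) :
    |weight σ u w * inner ℝ w v| ≤ ‖w - u‖ * ‖v‖ :=
  calc |weight σ u w * inner ℝ w v| ≤ |weight σ u w| * (‖w‖ * ‖v‖) := by
        rw [abs_mul]
        gcongr
        exact abs_real_inner_le_norm w v
    _ = |weight σ u w| * ‖w‖ * ‖v‖ := by ring
    _ ≤ ‖w - u‖ * ‖v‖ := by
        gcongr
        exact abs_weight_mul_norm_le σ u w

theorem sq_inner_div_norm_le (u v : E) : (inner ℝ u v / ‖u‖) ^ 2 ≤ ‖v‖ ^ 2 := by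
  rw [sq_le_sq, abs_div, abs_norm, abs_norm]
  exact div_le_of_le_mul₀ (norm_nonneg u) (norm_nonneg v)
    ((abs_real_inner_le_norm u v).trans_eq (mul_comm _ _))

theorem quotient_ge {r s t D : ℝ} (hσ : 0 < σ) (hδ : 0 ≤ δ) (hs : 0 < s)
    (hr : |r| ≤ δ * s ^ 2) (hD : σ * s ^ 2 ≤ D) (hD' : D ≤ 2 * ((4 + σ) * s ^ 2)) :
    (r / s) ^ 2 / (4 + σ) - 3 * δ / σ * t ^ 2 ≤ (2 * r + t ^ 2) * (r + t ^ 2) / D := by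
  have hDpos : 0 < D := lt_of_lt_of_le (by positivity) hD
  have main_term : (r / s) ^ 2 / (4 + σ) ≤ 2 * r ^ 2 / D := by
    rw [div_pow, div_div, div_le_div_iff₀ (by positivity) hDpos]
    linarith [mul_le_mul_of_nonneg_left hD' (sq_nonneg r)]
  have cross_term : 3 * |r| * t ^ 2 / D ≤ 3 * δ / σ * t ^ 2 :=
    calc 3 * |r| * t ^ 2 / D ≤ 3 * (δ * s ^ 2) * t ^ 2 / (σ * s ^ 2) := by gcongr
      _ = 3 * δ / σ * t ^ 2 := by field_simp
  have expand : 2 * r ^ 2 - 3 * |r| * t ^ 2 ≤ (2 * r + t ^ 2) * (r + t ^ 2) := by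
    nlinarith [mul_le_mul_of_nonneg_right (neg_abs_le r) (sq_nonneg t), sq_nonneg (t ^ 2)]
  calc (r / s) ^ 2 / (4 + σ) - 3 * δ / σ * t ^ 2 ≤ (2 * r ^ 2 - 3 * |r| * t ^ 2) / D := by
        rw [sub_div]
        linarith
    _ ≤ (2 * r + t ^ 2) * (r + t ^ 2) / D := by gcongr

theorem weight_mul_inner_ge_of_norm_le (hσ : 0 < σ) (hδ : 0 ≤ δ) (hδ' : δ ≤ 1) {u v : E}
    (hv : ‖v‖ ≤ δ * ‖u‖) :
    (inner ℝ u v / ‖u‖) ^ 2 / (4 + σ) - 3 * δ / σ * ‖v‖ ^ 2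
      ≤ weight σ u (u + v) * inner ℝ (u + v) v := by
  rcases (norm_nonneg u).eq_or_lt with hu | hu
  · have hv0 : v = 0 := norm_le_zero_iff.1 (hv.trans (by rw [← hu, mul_zero]))
    simp [hv0]
  have hr : |inner ℝ u v| ≤ δ * ‖u‖ ^ 2 :=
    (abs_real_inner_le_norm u v).trans (by nlinarith)
  have sq_le : ‖v‖ ^ 2 ≤ ‖u‖ ^ 2 := by
    gcongr
    exact hv.trans (mul_le_of_le_one_left hu.le hδ')
  have inner_le : inner ℝ u v ≤ ‖u‖ ^ 2 :=
    (le_abs_self _).trans (hr.trans (mul_le_of_le_one_left (sq_nonneg _) hδ'))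
  have : 0 < σ * ‖u‖ ^ 2 := by positivity
  have norm_add := norm_add_sq_real u v
  rw [weight, inner_add_left, real_inner_self_eq_norm_sq, mul_pow, Real.sq_sqrt hσ.le]
  set a := √(‖u‖ ^ 2 + σ * ‖u‖ ^ 2)
  set b := √(‖u + v‖ ^ 2 + σ * ‖u‖ ^ 2)
  have ha : 0 < a := Real.sqrt_pos.2 (by positivity)
  have hb : 0 < b := Real.sqrt_pos.2 (by positivity)
  have ha2 : a ^ 2 = ‖u‖ ^ 2 + σ * ‖u‖ ^ 2 := Real.sq_sqrt (by positivity)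
  have hb2 : b ^ 2 = ‖u + v‖ ^ 2 + σ * ‖u‖ ^ 2 := Real.sq_sqrt (by positivity)
  have hab : 0 < a * b := mul_pos ha hb
  have rationalize : (1 - a / b) * (inner ℝ u v + ‖v‖ ^ 2) =
      (2 * inner ℝ u v + ‖v‖ ^ 2) * (inner ℝ u v + ‖v‖ ^ 2) / (b ^ 2 + a * b) := by
    rw [show 2 * inner ℝ u v + ‖v‖ ^ 2 = b ^ 2 - a ^ 2 by rw [ha2, hb2]; linarith]
    field_simp
    ring
  rw [rationalize]
  exact quotient_ge hσ hδ hu hr (by linarith [sq_nonneg ‖u + v‖])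
    (by linarith [two_mul_le_add_sq a b, sq_nonneg ‖u‖])

theorem weight_mul_inner_ge (hσ : 0 < σ) (hδ : 0 ≤ δ) (hδ' : δ ≤ 1) (u v : E) :
    (inner ℝ u v / ‖u‖) ^ 2 / (4 + σ) - 3 * δ / σ * ‖v‖ ^ 2
        - 2 * (if δ * ‖u‖ < ‖v‖ then ‖v‖ ^ 2 else 0)
      ≤ weight σ u (u + v) * inner ℝ (u + v) v := by
  split_ifs with h
  · have lower := (abs_le.1 (abs_weight_mul_inner_le σ u (u + v) v)).1
    rw [add_sub_cancel_left] at lower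
    have upper : (inner ℝ u v / ‖u‖) ^ 2 / (4 + σ) ≤ ‖v‖ ^ 2 :=
      (div_le_self (sq_nonneg _) (by linarith)).trans (sq_inner_div_norm_le u v)
    have : 0 ≤ 3 * δ / σ * ‖v‖ ^ 2 := by positivity
    linarith
  · linarith [weight_mul_inner_ge_of_norm_le hσ hδ hδ' (not_lt.1 h)]

end Weight

section LocalRegularity

variable {d n : ℕ} {A : Fin n → QVec d} {x : QVec d} {σ δ τ T ε ρ : ℝ}

/-- The deterministic conditions on the measurement vectors from which the local regularity
condition at `x` follows. Directions `h` with `x^* h` real are those orthogonal to the orbit of `x`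
under the group of phases. -/
structure IsRegular (A : Fin n → QVec d) (x : QVec d) (τ T ε : ℝ) : Prop where
  gram_le (h : QVec d) : 𝔼 k, ‖qInner (A k) h‖ ^ 2 ≤ 2 * ‖h‖ ^ 2
  curvature_ge (h : QVec d) (hr : ∃ r : ℝ, qInner x h = r) : 1 / 8 * ‖h‖ ^ 2 ≤
    𝔼 k, (inner ℝ (qInner (A k) x) (qInner (A k) h) / ‖qInner (A k) x‖) ^ 2
  small_le (h : QVec d) :
    𝔼 k, (if ‖qInner (A k) x‖ < τ * ‖x‖ then ‖qInner (A k) h‖ ^ 2 else 0) ≤ ε * ‖h‖ ^ 2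
  tail_le (h : QVec d) :
    𝔼 k, (if T * ‖h‖ < ‖qInner (A k) h‖ then ‖qInner (A k) h‖ ^ 2 else 0) ≤ ε * ‖h‖ ^ 2

theorem mul_star_of_norm_eq_one {w : ℍ[ℝ]} (hw : ‖w‖ = 1) : w * star w = 1 := by
  rw [Quaternion.self_mul_star, Quaternion.normSq_eq_norm_mul_self, hw]
  simp

theorem norm_qInner_rightMul (a x : QVec d) {w : ℍ[ℝ]} (hw : ‖w‖ = 1) :
    ‖qInner a (rightMul x w)‖ = ‖qInner a x‖ := by
  rw [qInner_rightMul_right, norm_mul, hw, mul_one]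

theorem real_inner_mul_left (u v w : ℍ[ℝ]) : inner ℝ (u * w) v = inner ℝ u (v * star w) := by
  rw [Quaternion.inner_def, Quaternion.inner_def, star_mul, star_star, mul_assoc]

theorem IsRegular.rightMul_of_norm_eq_one (hA : IsRegular A x τ T ε) {w : ℍ[ℝ]} (hw : ‖w‖ = 1) :
    IsRegular A (rightMul x w) τ T ε where
  gram_le := hA.gram_le
  curvature_ge h := by
    rintro ⟨r, hr⟩
    have real : qInner x (rightMul h (star w)) = r := by
      rw [qInner_rightMul_left] at hr
      calc qInner x (rightMul h (star w)) = w * star w * (qInner x h * star w) := by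
            rw [qInner_rightMul_right, mul_star_of_norm_eq_one hw, one_mul]
        _ = w * (r : ℍ[ℝ]) * star w := by rw [← hr]; noncomm_ring
        _ = r := by rw [← Quaternion.coe_commutes, mul_assoc, mul_star_of_norm_eq_one hw, mul_one]
    have := hA.curvature_ge _ ⟨r, real⟩
    rw [norm_rightMul, norm_star, hw, mul_one] at this
    simpa only [qInner_rightMul_right, real_inner_mul_left, norm_mul, hw, mul_one] using this
  small_le h := by
    simpa only [norm_qInner_rightMul _ _ hw, norm_rightMul, hw, mul_one] using hA.small_le h
  tail_le := hA.tail_le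

theorem amplitudes_rightMul (A : Fin n → QVec d) (x : QVec d) {w : ℍ[ℝ]} (hw : ‖w‖ = 1) :
    amplitudes A (rightMul x w) = amplitudes A x :=
  funext fun k => norm_qInner_rightMul (A k) x hw

theorem qInner_phase_deviation (x z : QVec d) :
    qInner (rightMul x (phase x z)) (z - rightMul x (phase x z)) =
      ((‖qInner x z‖ - ‖x‖ ^ 2 : ℝ) : ℍ[ℝ]) := by
  rw [qInner_sub_right, qInner_self, qInner_rightMul_left, norm_rightMul, norm_phase, mul_one,
    phase, star_qSign_mul, Quaternion.coe_sub]

theorem inner_gradient_left (A : Fin n → QVec d) (σ : ℝ) (x h y : QVec d) :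
    inner ℝ (gradient A (amplitudes A x) (perturbation σ (amplitudes A x)) (x + h)) y =
      𝔼 k, weight σ (qInner (A k) x) (qInner (A k) x + qInner (A k) h) *
        inner ℝ (qInner (A k) x + qInner (A k) h) (qInner (A k) y) := by
  rw [gradient_eq_weightedGram, inner_weightedGram_left]
  simp only [weight, amplitudes, perturbation, qInner_add_right]

theorem IsRegular.norm_gradient_sq_le (hA : IsRegular A x τ T ε) (h : QVec d) :
    ‖gradient A (amplitudes A x) (perturbation σ (amplitudes A x)) (x + h)‖ ^ 2
      ≤ 4 * ‖h‖ ^ 2 := by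
  set G := gradient A (amplitudes A x) (perturbation σ (amplitudes A x)) (x + h) with hG
  have term_le (k : Fin n) : weight σ (qInner (A k) x) (qInner (A k) x + qInner (A k) h) *
      inner ℝ (qInner (A k) x + qInner (A k) h) (qInner (A k) G)
      ≤ ‖qInner (A k) h‖ ^ 2 + ‖qInner (A k) G‖ ^ 2 / 4 := by
    have := (abs_le.1 (abs_weight_mul_inner_le σ (qInner (A k) x)
      (qInner (A k) x + qInner (A k) h) (qInner (A k) G))).2
    rw [add_sub_cancel_left] at this
    nlinarith [sq_nonneg (‖qInner (A k) h‖ - ‖qInner (A k) G‖ / 2)]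
  have sum_le := Finset.expect_le_expect fun k (_ : k ∈ Finset.univ) => term_le k
  rw [← inner_gradient_left, ← hG, real_inner_self_eq_norm_sq, Finset.expect_add_distrib,
    ← Finset.expect_div] at sum_le
  linarith [hA.gram_le h, hA.gram_le G]

/-- For `h` small compared with `x`, a summand can leave the basin `‖α_k^* h‖ ≤ δ ‖α_k^* x‖` only
if `α_k^* x` is atypically small or `α_k^* h` atypically large. -/
theorem ite_deviation_le (hδ : 0 ≤ δ) (hT : 0 ≤ T) (hρ : T * ρ ≤ δ * τ) {h : QVec d}
    (hh : ‖h‖ ≤ ρ * ‖x‖) (a : QVec d) :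
    (if δ * ‖qInner a x‖ < ‖qInner a h‖ then ‖qInner a h‖ ^ 2 else 0)
      ≤ (if ‖qInner a x‖ < τ * ‖x‖ then ‖qInner a h‖ ^ 2 else 0)
        + (if T * ‖h‖ < ‖qInner a h‖ then ‖qInner a h‖ ^ 2 else 0) := by
  have cases_of_large (large : δ * ‖qInner a x‖ < ‖qInner a h‖) :
      ‖qInner a x‖ < τ * ‖x‖ ∨ T * ‖h‖ < ‖qInner a h‖ := by
    by_contra! typical
    refine large.not_ge ?_
    calc ‖qInner a h‖ ≤ T * ‖h‖ := typical.2
      _ ≤ T * (ρ * ‖x‖) := by gcongr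
      _ = T * ρ * ‖x‖ := by ring
      _ ≤ δ * τ * ‖x‖ := by gcongr
      _ = δ * (τ * ‖x‖) := by ring
      _ ≤ δ * ‖qInner a x‖ := by gcongr; exact typical.1
  have := sq_nonneg ‖qInner a h‖
  split_ifs <;> first | linarith | simp_all

theorem IsRegular.inner_gradient_ge (hA : IsRegular A x τ T ε) (hσ : 0 < σ) (hδ : 0 ≤ δ)
    (hδ' : δ ≤ 1) (hδσ : 3 * δ / σ * 2 ≤ 1 / (64 * (4 + σ))) (hε : 4 * ε ≤ 1 / (64 * (4 + σ)))
    (hT : 0 ≤ T) (hρ : T * ρ ≤ δ * τ) {h : QVec d} (hh : ‖h‖ ≤ ρ * ‖x‖)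
    (hr : ∃ r : ℝ, qInner x h = r) :
    1 / (16 * (4 + σ)) * ‖h‖ ^ 2 ≤
      inner ℝ (gradient A (amplitudes A x) (perturbation σ (amplitudes A x)) (x + h)) h := by
  have term_ge (k : Fin n) :
      (inner ℝ (qInner (A k) x) (qInner (A k) h) / ‖qInner (A k) x‖) ^ 2 / (4 + σ)
        - 3 * δ / σ * ‖qInner (A k) h‖ ^ 2
        - 2 * ((if ‖qInner (A k) x‖ < τ * ‖x‖ then ‖qInner (A k) h‖ ^ 2 else 0)
          + (if T * ‖h‖ < ‖qInner (A k) h‖ then ‖qInner (A k) h‖ ^ 2 else 0))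
      ≤ weight σ (qInner (A k) x) (qInner (A k) x + qInner (A k) h) *
        inner ℝ (qInner (A k) x + qInner (A k) h) (qInner (A k) h) := by
    linarith [weight_mul_inner_ge hσ hδ hδ' (qInner (A k) x) (qInner (A k) h),
      ite_deviation_le hδ hT hρ hh (A k)]
  have sum_ge := Finset.expect_le_expect fun k (_ : k ∈ Finset.univ) => term_ge k
  rw [← inner_gradient_left, Finset.expect_sub_distrib, Finset.expect_sub_distrib,
    ← Finset.expect_div, ← Finset.mul_expect, ← Finset.mul_expect,
    Finset.expect_add_distrib] at sum_ge
  have curvature : 1 / 8 * ‖h‖ ^ 2 / (4 + σ) ≤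
      (𝔼 k, (inner ℝ (qInner (A k) x) (qInner (A k) h) / ‖qInner (A k) x‖) ^ 2) / (4 + σ) := by
    gcongr
    exact hA.curvature_ge h hr
  have remainder : 3 * δ / σ * 𝔼 k, ‖qInner (A k) h‖ ^ 2 ≤ 1 / (64 * (4 + σ)) * ‖h‖ ^ 2 :=
    calc 3 * δ / σ * 𝔼 k, ‖qInner (A k) h‖ ^ 2 ≤ 3 * δ / σ * (2 * ‖h‖ ^ 2) := by
          gcongr
          exact hA.gram_le h
      _ ≤ 1 / (64 * (4 + σ)) * ‖h‖ ^ 2 := by rw [← mul_assoc]; gcongr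
  have exceptional : 4 * ε * ‖h‖ ^ 2 ≤ 1 / (64 * (4 + σ)) * ‖h‖ ^ 2 := by gcongr
  have total : 1 / (16 * (4 + σ)) * ‖h‖ ^ 2 + 1 / (16 * (4 + σ)) * ‖h‖ ^ 2 =
      1 / 8 * ‖h‖ ^ 2 / (4 + σ) := by
    field_simp; ring
  have share : 4 * (1 / (64 * (4 + σ)) * ‖h‖ ^ 2) = 1 / (16 * (4 + σ)) * ‖h‖ ^ 2 := by
    field_simp; ring
  have : 0 ≤ 1 / (64 * (4 + σ)) * ‖h‖ ^ 2 := by positivity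
  linarith [hA.small_le h, hA.tail_le h]

theorem IsRegular.lrc (hA : IsRegular A x τ T ε) (hσ : 0 < σ) (hδ : 0 ≤ δ) (hδ' : δ ≤ 1)
    (hδσ : 3 * δ / σ * 2 ≤ 1 / (64 * (4 + σ))) (hε : 4 * ε ≤ 1 / (64 * (4 + σ))) (hT : 0 ≤ T)
    (hρ : T * ρ ≤ δ * τ) :
    LRC (gradient A (amplitudes A x) (perturbation σ (amplitudes A x))) x
      (1 / (128 * (4 + σ))) (1 / (16 * (4 + σ))) ρ := by
  intro z hz
  have hφ : ‖phase x z‖ = 1 := norm_phase x z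
  have hA' := hA.rightMul_of_norm_eq_one hφ
  rw [phaseDist_eq_norm_sub_phase, re_qInner, ← amplitudes_rightMul A x hφ]
  set y := rightMul x (phase x z) with hy
  have hyx : ‖y‖ = ‖x‖ := by rw [hy, norm_rightMul, hφ, mul_one]
  set h := z - y
  have decompose : y + h = z := add_sub_cancel y z
  have curvature := hA'.inner_gradient_ge hσ hδ hδ' hδσ hε hT hρ (hz.trans_eq (by rw [hyx]))
    ⟨_, qInner_phase_deviation x z⟩
  have bound := hA'.norm_gradient_sq_le (σ := σ) h
  rw [decompose] at curvature bound
  set G := gradient A (amplitudes A y) (perturbation σ (amplitudes A y)) z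
  calc 1 / (16 * (4 + σ)) / 2 * ‖h‖ ^ 2 + 1 / (128 * (4 + σ)) / 2 * ‖G‖ ^ 2
      ≤ 1 / (16 * (4 + σ)) / 2 * ‖h‖ ^ 2 + 1 / (128 * (4 + σ)) / 2 * (4 * ‖h‖ ^ 2) := by gcongr
    _ = 3 / 4 * (1 / (16 * (4 + σ)) * ‖h‖ ^ 2) := by field_simp; ring
    _ ≤ 1 / (16 * (4 + σ)) * ‖h‖ ^ 2 := mul_le_of_le_one_left (by positivity) (by norm_num)
    _ ≤ inner ℝ G h := curvature

end LocalRegularity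

/-! ### Leading eigenvectors and the spectral initialization -/

section Spectral

variable {d n : ℕ}

theorem exists_eigenvector_isMaxOn_rayleigh {E : Type*} [NormedAddCommGroup E]
    [InnerProductSpace ℝ E] [FiniteDimensional ℝ E] [Nontrivial E] {T : E →L[ℝ] E}
    (hT : IsSelfAdjoint T) :
    ∃ v : E, ‖v‖ = 1 ∧ T v = (inner ℝ (T v) v : ℝ) • v ∧
      ∀ y : E, inner ℝ (T y) y ≤ inner ℝ (T v) v * ‖y‖ ^ 2 := by
  have : ProperSpace E := FiniteDimensional.proper ℝ E
  obtain ⟨v, hv, hmax⟩ := (isCompact_sphere (0 : E) 1).exists_isMaxOn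
    (NormedSpace.sphere_nonempty.2 zero_le_one) T.reApplyInnerSelf_continuous.continuousOn
  rw [mem_sphere_zero_iff_norm] at hv
  have eigenvector := IsSelfAdjoint.hasEigenvector_of_isMaxOn hT (norm_ne_zero_iff.1 (by simp [hv]))
    (hv.symm ▸ hmax)
  have apply_eq : T v = _ := eigenvector.apply_eq_smul
  refine ⟨v, hv, ?_, fun y => ?_⟩
  · conv_rhs => rw [apply_eq, real_inner_smul_left, real_inner_self_eq_norm_sq, hv]
    rw [apply_eq, one_pow, mul_one]
  · rcases eq_or_ne y 0 with rfl | hy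
    · simp
    have le_max : inner ℝ (T (‖y‖⁻¹ • y)) (‖y‖⁻¹ • y) ≤ inner ℝ (T v) v :=
      hmax (by simp [norm_smul, hy])
    rw [map_smul, real_inner_smul_left, real_inner_smul_right, ← mul_assoc, ← sq, inv_pow,
      inv_mul_le_iff₀ (by positivity)] at le_max
    rwa [mul_comm]

theorem inner_weightedGram_self (A : Fin n → QVec d) (w : Fin n → ℝ) (y : QVec d) :
    inner ℝ (weightedGram A w y) y = 𝔼 k, w k * ‖qInner (A k) y‖ ^ 2 := by
  simp only [inner_weightedGram_left, real_inner_self_eq_norm_sq]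

theorem isSelfAdjoint_weightedGram (A : Fin n → QVec d) (w : Fin n → ℝ) :
    IsSelfAdjoint (weightedGram A w) := by
  rw [ContinuousLinearMap.isSelfAdjoint_iff_isSymmetric]
  intro y z
  simp only [ContinuousLinearMap.coe_coe]
  change inner ℝ (weightedGram A w y) z = inner ℝ y (weightedGram A w z)
  rw [real_inner_comm _ y, inner_weightedGram_left, inner_weightedGram_left]
  exact Finset.expect_congr rfl fun k _ => by rw [real_inner_comm]

/-- The initialization matrix `S_in` as a real-linear operator on `ℍ^d`. -/
def initOperator (A : Fin n → QVec d) (ψ : Fin n → ℝ) (γ : ℝ) : QVec d →L[ℝ] QVec d :=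
  weightedGram A fun k => γ - Real.exp (-(ψ k ^ 2 / normEstimate ψ ^ 2))

theorem initMatrix_mulVec (A : Fin n → QVec d) (ψ : Fin n → ℝ) (γ : ℝ) (v : QVec d) (i : Fin d) :
    ∑ j, initMatrix A ψ γ i j * v j = initOperator A ψ γ v i := by
  simp only [initOperator, weightedGram_apply, initMatrix, rightMul, qInner,
    WithLp.ofLp_sum, Finset.sum_apply, WithLp.ofLp_smul, Pi.smul_apply, smul_mul_assoc,
    Finset.sum_mul, Finset.mul_sum, Finset.smul_sum, mul_assoc]
  exact Finset.sum_comm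

theorem isRightEigenpair_initMatrix_iff {A : Fin n → QVec d} {ψ : Fin n → ℝ} {γ : ℝ} {q : ℍ[ℝ]}
    {v : QVec d} : IsRightEigenpair (initMatrix A ψ γ) q v ↔
      v ≠ 0 ∧ initOperator A ψ γ v = rightMul v q := by
  simp only [IsRightEigenpair, initMatrix_mulVec]
  exact and_congr_right fun _ => ⟨fun h => PiLp.ext h, fun h i => by rw [h]; rfl⟩

theorem rightMul_coe (v : QVec d) (r : ℝ) : rightMul v (r : ℍ[ℝ]) = r • v :=
  PiLp.ext fun i => by
    rw [PiLp.smul_apply, ← Quaternion.coe_mul_eq_smul, Quaternion.coe_commutes]; rfl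

theorem inner_rightMul_self (v : QVec d) (q : ℍ[ℝ]) :
    inner ℝ (rightMul v q) v = q.re * ‖v‖ ^ 2 := by
  rw [real_inner_rightMul_left, qInner_self, Quaternion.inner_def, Quaternion.star_coe,
    Quaternion.mul_coe_eq_smul, Quaternion.re_smul, smul_eq_mul, mul_comm]

theorem exists_isLeadingEigenvector [Nontrivial (QVec d)] (A : Fin n → QVec d) (ψ : Fin n → ℝ)
    (γ : ℝ) : ∃ v, IsLeadingEigenvector (initMatrix A ψ γ) v := by
  obtain ⟨v, hv1, hv, hmax⟩ := exists_eigenvector_isMaxOn_rayleigh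
    (show IsSelfAdjoint (initOperator A ψ γ) from isSelfAdjoint_weightedGram A _)
  refine ⟨v, hv1, inner ℝ (initOperator A ψ γ v) v, isRightEigenpair_initMatrix_iff.2
    ⟨norm_ne_zero_iff.1 (by simp [hv1]), by rw [rightMul_coe, ← hv]⟩, ?_⟩
  rintro q ⟨⟨y, hy⟩, -⟩
  obtain ⟨hy0, hy⟩ := isRightEigenpair_initMatrix_iff.1 hy
  have := hmax y
  rw [hy, inner_rightMul_self] at this
  exact le_of_mul_le_mul_right this (by positivity)

theorem IsLeadingEigenvector.rayleigh_le {A : Fin n → QVec d} {ψ : Fin n → ℝ} {γ : ℝ}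
    {v : QVec d} (hv : IsLeadingEigenvector (initMatrix A ψ γ) v) (y : QVec d) :
    inner ℝ (initOperator A ψ γ y) y ≤ inner ℝ (initOperator A ψ γ v) v * ‖y‖ ^ 2 := by
  obtain ⟨hv1, m, hm, hmax⟩ := hv
  obtain ⟨hv0, hm⟩ := isRightEigenpair_initMatrix_iff.1 hm
  have : Nontrivial (QVec d) := nontrivial_of_ne v 0 hv0
  obtain ⟨u, hu1, hu, humax⟩ := exists_eigenvector_isMaxOn_rayleigh
    (show IsSelfAdjoint (initOperator A ψ γ) from isSelfAdjoint_weightedGram A _)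
  have le_m : inner ℝ (initOperator A ψ γ u) u ≤ m :=
    hmax (inner ℝ (initOperator A ψ γ u) u : ℝ) ⟨⟨u, isRightEigenpair_initMatrix_iff.2
      ⟨norm_ne_zero_iff.1 (by simp [hu1]), by rw [rightMul_coe, ← hu]⟩⟩, by simp, by simp, by simp⟩
  rw [hm, inner_rightMul_self, Quaternion.re_coe, hv1, one_pow, mul_one]
  exact (humax y).trans (by gcongr)

theorem abs_exp_neg_sub_exp_neg_mul_le {a c : ℝ} (ha : 0 ≤ a) (hc : 0 ≤ c) :
    |Real.exp (-a) - Real.exp (-((1 + c) * a))| ≤ c := by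
  have factor : Real.exp (-((1 + c) * a)) = Real.exp (-a) * Real.exp (-(c * a)) := by
    rw [← Real.exp_add]; congr 1; ring
  have le_one : Real.exp (-(c * a)) ≤ 1 := Real.exp_le_one_iff.2 (by nlinarith)
  have ge_one_sub : 1 - c * a ≤ Real.exp (-(c * a)) := by
    linarith [Real.add_one_le_exp (-(c * a))]
  have exp_mul_le : Real.exp (-a) * a ≤ 1 := by
    rw [Real.exp_neg, inv_mul_le_iff₀ (Real.exp_pos a)]
    linarith [Real.add_one_le_exp a]
  have := Real.exp_pos (-a)
  rw [factor, abs_of_nonneg (by nlinarith)]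
  nlinarith [mul_le_mul_of_nonneg_left ge_one_sub this.le,
    mul_le_mul_of_nonneg_left exp_mul_le hc]

theorem abs_exp_neg_div_sub_exp_neg_le {s m δ : ℝ} (hs : 0 ≤ s) (hδ : δ ≤ 1 / 2)
    (hm : |m - 1| ≤ δ) : |Real.exp (-(s / m)) - Real.exp (-s)| ≤ 2 * δ := by
  rw [abs_le] at hm
  have hm0 : 0 < m := by linarith
  rcases le_total 1 m with h | h
  · have := abs_exp_neg_sub_exp_neg_mul_le (div_nonneg hs hm0.le) (sub_nonneg.2 h)
    rw [show (1 + (m - 1)) * (s / m) = s by field_simp; ring] at this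
    linarith
  · have := abs_exp_neg_sub_exp_neg_mul_le hs (div_nonneg (sub_nonneg.2 h) hm0.le)
    rw [show (1 + (1 - m) / m) * s = s / m by field_simp; ring, abs_sub_comm] at this
    refine this.trans ?_
    rw [div_le_iff₀ hm0]
    nlinarith

variable {A : Fin n → QVec d} {x v : QVec d} {κ q δ ρ γ : ℝ}

/-- The deterministic conditions on the measurement vectors under which the spectral initial guess
is accurate: concentration of the plain Gram form and of the one attenuated by
`exp (-(|α_k^* x| / ‖x‖)²)`. The gap `κ` separates the direction of `x` from its orthogonal
complement. -/
structure HasSpectralGap (A : Fin n → QVec d) (x : QVec d) (κ q δ : ℝ) : Prop where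
  gram (h : QVec d) : |𝔼 k, ‖qInner (A k) h‖ ^ 2 - ‖h‖ ^ 2| ≤ δ * ‖h‖ ^ 2
  attenuated (h : QVec d) :
    |𝔼 k, Real.exp (-(‖qInner (A k) x‖ / ‖x‖) ^ 2) * ‖qInner (A k) h‖ ^ 2
      - (q * ‖h‖ ^ 2 - κ * (‖qInner x h‖ / ‖x‖) ^ 2)| ≤ δ * ‖h‖ ^ 2

theorem normEstimate_amplitudes_sq (A : Fin n → QVec d) (x : QVec d) :
    normEstimate (amplitudes A x) ^ 2 = 𝔼 k, ‖qInner (A k) x‖ ^ 2 := by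
  rw [normEstimate, Real.sq_sqrt (by positivity), one_div_mul_sum_eq_expect]
  rfl

theorem HasSpectralGap.abs_attenuation_sub_le (hA : HasSpectralGap A x κ q δ) (hδ : δ ≤ 1 / 2)
    (hx : x ≠ 0) (h : QVec d) :
    |𝔼 k, Real.exp (-(amplitudes A x k ^ 2 / normEstimate (amplitudes A x) ^ 2)) *
        ‖qInner (A k) h‖ ^ 2
      - 𝔼 k, Real.exp (-(‖qInner (A k) x‖ / ‖x‖) ^ 2) * ‖qInner (A k) h‖ ^ 2|
      ≤ 2 * δ * 𝔼 k, ‖qInner (A k) h‖ ^ 2 := by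
  have hx2 : 0 < ‖x‖ ^ 2 := by positivity
  have ratio : |normEstimate (amplitudes A x) ^ 2 / ‖x‖ ^ 2 - 1| ≤ δ := by
    rw [normEstimate_amplitudes_sq, div_sub_one hx2.ne', abs_div, abs_of_pos hx2, div_le_iff₀ hx2]
    exact hA.gram x
  rw [← Finset.expect_sub_distrib, Finset.mul_expect]
  refine (Finset.abs_expect_le _ _).trans (Finset.expect_le_expect fun k _ => ?_)
  rw [← sub_mul, abs_mul, abs_of_nonneg (sq_nonneg ‖qInner (A k) h‖)]
  gcongr
  have := abs_exp_neg_div_sub_exp_neg_le (sq_nonneg (‖qInner (A k) x‖ / ‖x‖)) hδ ratio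
  rw [div_pow] at this ⊢
  rwa [div_div_div_cancel_right₀ hx2.ne'] at this

theorem HasSpectralGap.abs_inner_initOperator_sub_le (hA : HasSpectralGap A x κ q δ)
    (hδ : δ ≤ 1 / 2) (hx : x ≠ 0) (γ : ℝ) (h : QVec d) :
    |inner ℝ (initOperator A (amplitudes A x) γ h) h
      - ((γ - q) * ‖h‖ ^ 2 + κ * (‖qInner x h‖ / ‖x‖) ^ 2)| ≤ (5 + |γ|) * δ * ‖h‖ ^ 2 := by
  have attenuation := hA.abs_attenuation_sub_le hδ hx h
  have attenuated := hA.attenuated h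
  have gram := hA.gram h
  rw [initOperator, inner_weightedGram_self]
  simp only [sub_mul, Finset.expect_sub_distrib, ← Finset.mul_expect]
  set M := 𝔼 k, ‖qInner (A k) h‖ ^ 2
  have gram_mul : |γ * (M - ‖h‖ ^ 2)| ≤ |γ| * (δ * ‖h‖ ^ 2) := by rw [abs_mul]; gcongr
  have hδ0 : 0 ≤ δ := by
    have hx2 : 0 < ‖x‖ ^ 2 := by positivity
    exact nonneg_of_mul_nonneg_left ((abs_nonneg _).trans (hA.gram x)) hx2
  have M_le : 2 * δ * M ≤ 2 * δ * (2 * ‖h‖ ^ 2) := by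
    gcongr
    nlinarith [(abs_le.1 gram).2, sq_nonneg ‖h‖]
  rw [abs_le] at *
  constructor <;> linarith [attenuation.1, attenuation.2]

theorem HasSpectralGap.norm_sub_norm_qInner_le (hA : HasSpectralGap A x κ q δ) (hκ : 0 < κ)
    (hδ : δ ≤ 1 / 2) (hx : x ≠ 0)
    (hv : IsLeadingEigenvector (initMatrix A (amplitudes A x) γ) v) :
    ‖x‖ - ‖qInner x v‖ ≤ (10 + 2 * |γ|) * δ / κ * ‖x‖ := by
  have hs : 0 < ‖x‖ := norm_pos_iff.2 hx
  have at_x := hA.abs_inner_initOperator_sub_le hδ hx γ x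
  have at_v := hA.abs_inner_initOperator_sub_le hδ hx γ v
  have rayleigh := hv.rayleigh_le x
  have correlation_le_one : ‖qInner x v‖ / ‖x‖ ≤ 1 := by
    rw [div_le_one₀ hs]
    simpa [hv.1] using norm_qInner_le x v
  rw [hv.1] at at_v
  rw [qInner_self, Quaternion.norm_coe, Real.norm_eq_abs, abs_of_nonneg (sq_nonneg ‖x‖),
    sq ‖x‖, mul_div_cancel_right₀ _ hs.ne', ← sq] at at_x
  set c := ‖qInner x v‖ / ‖x‖ with hc
  have hc0 : 0 ≤ c := by positivity
  have gap_mul : κ * (1 - c ^ 2) * ‖x‖ ^ 2 ≤ (10 + 2 * |γ|) * δ * ‖x‖ ^ 2 := by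
    have := mul_le_mul_of_nonneg_right (abs_le.1 at_v).2 (sq_nonneg ‖x‖)
    linarith [(abs_le.1 at_x).1]
  have gap : κ * (1 - c ^ 2) ≤ (10 + 2 * |γ|) * δ := le_of_mul_le_mul_right gap_mul (by positivity)
  have one_sub_le : 1 - c ≤ (10 + 2 * |γ|) * δ / κ := by
    rw [le_div_iff₀ hκ]
    nlinarith [mul_nonneg hκ.le (mul_nonneg hc0 (sub_nonneg.2 correlation_le_one))]
  calc ‖x‖ - ‖qInner x v‖ = (1 - c) * ‖x‖ := by rw [hc]; field_simp
    _ ≤ (10 + 2 * |γ|) * δ / κ * ‖x‖ := by gcongr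

theorem HasSpectralGap.phaseDist_initial_le (hA : HasSpectralGap A x κ q δ) (hκ : 0 < κ)
    (hδ : δ ≤ 1 / 2) (hρ : 0 ≤ ρ) (hδρ : δ * (1 + (40 + 8 * |γ|) / κ) ≤ ρ ^ 2) (hx : x ≠ 0)
    (hv : IsLeadingEigenvector (initMatrix A (amplitudes A x) γ) v) :
    phaseDist (normEstimate (amplitudes A x) • v) x ≤ ρ * ‖x‖ := by
  have correlation := hA.norm_sub_norm_qInner_le hκ hδ hx hv
  have correlation_le : ‖qInner x v‖ ≤ ‖x‖ := by simpa [hv.1] using norm_qInner_le x v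
  have gram := hA.gram x
  rw [← normEstimate_amplitudes_sq] at gram
  have scale_nonneg : 0 ≤ normEstimate (amplitudes A x) := Real.sqrt_nonneg _
  refine (pow_le_pow_iff_left₀ (phaseDist_nonneg _ _) (by positivity) two_ne_zero).1 ?_
  rw [phaseDist_sq, qInner_smul_right, norm_smul, norm_smul, hv.1, mul_one, Real.norm_eq_abs,
    abs_of_nonneg scale_nonneg]
  set l := normEstimate (amplitudes A x)
  set s := ‖x‖
  set c := ‖qInner x v‖
  have scale_le : l ≤ 2 * s := by
    refine (pow_le_pow_iff_left₀ scale_nonneg (by positivity) two_ne_zero).1 ?_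
    nlinarith [(abs_le.1 gram).2, sq_nonneg s]
  have scale_error : (l - s) ^ 2 ≤ δ * s ^ 2 :=
    calc (l - s) ^ 2 = |l - s| * |l - s| := by rw [← sq_abs, sq]
      _ ≤ |l - s| * |l + s| := by
          refine mul_le_mul_of_nonneg_left ?_ (abs_nonneg _)
          rw [abs_of_nonneg (by positivity : 0 ≤ l + s), abs_le]
          constructor <;> linarith [norm_nonneg x]
      _ = |l ^ 2 - s ^ 2| := by rw [← abs_mul]; ring_nf
      _ ≤ δ * s ^ 2 := gram
  calc l ^ 2 + s ^ 2 - 2 * (l * c) = (l - s) ^ 2 + 2 * l * (s - c) := by ring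
    _ ≤ δ * s ^ 2 + 2 * (2 * s) * ((10 + 2 * |γ|) * δ / κ * s) := by gcongr
    _ = δ * (1 + (40 + 8 * |γ|) / κ) * s ^ 2 := by ring
    _ ≤ ρ ^ 2 * s ^ 2 := by gcongr
    _ = (ρ * s) ^ 2 := by ring

end Spectral

/-! ### Quaternionic Gaussian vectors -/

instance : MeasurableSpace ℍ[ℝ] := borel _

instance : BorelSpace ℍ[ℝ] := ⟨rfl⟩

section HalfGaussian

/-- The centred Gaussian measure with covariance `1/4` on a Euclidean space: the law of a
measurement vector `α_k`, and of `α_k^* h` when `‖h‖ = 1`. -/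
def halfGaussian (E : Type*) [NormedAddCommGroup E] [InnerProductSpace ℝ E]
    [FiniteDimensional ℝ E] [MeasurableSpace E] : Measure E :=
  (stdGaussian E).map ((1 / 2 : ℝ) • ·)

variable {E F : Type*} [NormedAddCommGroup E] [InnerProductSpace ℝ E] [FiniteDimensional ℝ E]
  [MeasurableSpace E] [BorelSpace E] [NormedAddCommGroup F] [InnerProductSpace ℝ F]
  [FiniteDimensional ℝ F] [MeasurableSpace F] [BorelSpace F]

instance : IsProbabilityMeasure (halfGaussian E) :=
  Measure.isProbabilityMeasure_map (by fun_prop)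

theorem charFun_halfGaussian (t : E) :
    charFun (halfGaussian E) t = Complex.exp (-‖t‖ ^ 2 / 8) := by
  rw [halfGaussian, charFun_map_smul, charFun_stdGaussian, norm_smul]
  congr 1
  push_cast
  norm_num
  ring

theorem charFun_map_halfGaussian {f : E → F} {g : F → E} (hf : Measurable f)
    (hfg : ∀ a t, inner ℝ (f a) t = inner ℝ a (g t)) (t : F) :
    charFun ((halfGaussian E).map f) t = Complex.exp (-‖g t‖ ^ 2 / 8) := by
  rw [charFun_apply, integral_map hf.aemeasurable (Measurable.aestronglyMeasurable (by fun_prop))]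
  simp only [hfg]
  rw [← charFun_apply, charFun_halfGaussian]

theorem charFun_map_toLp_pi_gaussianReal {ι : Type*} [Fintype ι] (t : EuclideanSpace ℝ ι) :
    charFun ((Measure.pi fun _ : ι => gaussianReal 0 (1 / 4)).map (WithLp.toLp 2)) t =
      Complex.exp (-‖t‖ ^ 2 / 8) := by
  simp only [charFun_pi, charFun_gaussianReal, ← Complex.exp_sum, ← Complex.ofReal_pow,
    EuclideanSpace.real_norm_sq_eq]
  push_cast
  rw [← Finset.sum_neg_distrib, Finset.sum_div]
  congr 1
  exact Finset.sum_congr rfl fun i _ => by ring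

end HalfGaussian

section JointLaw

variable {d n : ℕ}

/-- All real coordinates of a family of quaternionic vectors. -/
def arrayCoords (a : Fin n → QVec d) : EuclideanSpace ℝ (Fin n × Fin d × Fin 4) :=
  WithLp.toLp 2 fun p => coords (a p.1 p.2.1) p.2.2

theorem inner_arrayCoords (a b : Fin n → QVec d) :
    inner ℝ (arrayCoords a) (arrayCoords b) = ∑ k, inner ℝ (a k) (b k) := by
  simp only [PiLp.inner_apply, arrayCoords, Fintype.sum_prod_type]
  simp [Fin.sum_univ_four, coords, Quaternion.inner_def, Quaternion.re_mul, mul_comm]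

/-- The vector with given real coordinates. -/
def ofCoords (f : Fin d × Fin 4 → ℝ) : QVec d :=
  WithLp.toLp 2 fun j => Quaternion.linearIsometryEquivTuple.symm
    (WithLp.toLp 2 fun c => f (j, c))

theorem ofCoords_coords (a : QVec d) : ofCoords (fun p => coords (a p.1) p.2) = a := by
  refine PiLp.ext fun j => ?_
  ext <;> simp [ofCoords, coords]

theorem continuous_ofCoords : Continuous (ofCoords : (Fin d × Fin 4 → ℝ) → QVec d) := by
  refine (PiLp.continuous_toLp 2 _).comp (continuous_pi fun j => ?_)
  refine (LinearIsometryEquiv.continuous _).comp ((PiLp.continuous_toLp 2 _).comp ?_)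
  fun_prop

variable {Ω : Type*} [MeasurableSpace Ω] {P : Measure Ω} {α : Fin n → Ω → QVec d}

theorem IsQuaternionGaussian.aemeasurable (h : IsQuaternionGaussian P α) (k : Fin n) :
    AEMeasurable (α k) P := by
  have coords_aemeasurable : AEMeasurable (fun ω (p : Fin d × Fin 4) => coords (α k ω p.1) p.2) P :=
    aemeasurable_pi_lambda _ fun p => (h.law k p.1 p.2).aemeasurable
  simpa only [Function.comp_def, ofCoords_coords] using
    continuous_ofCoords.measurable.comp_aemeasurable coords_aemeasurable

variable [IsProbabilityMeasure P]

theorem IsQuaternionGaussian.hasLaw_joint (h : IsQuaternionGaussian P α) :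
    HasLaw (fun ω => WithLp.toLp 2 (α · ω))
      (halfGaussian (PiLp 2 fun _ : Fin n => QVec d)) P := by
  have joint_aemeasurable : AEMeasurable (fun ω => WithLp.toLp 2 (α · ω)) P :=
    (PiLp.continuous_toLp 2 _).measurable.comp_aemeasurable
      (aemeasurable_pi_lambda _ h.aemeasurable)
  have := Measure.isProbabilityMeasure_map joint_aemeasurable
  have coords_hasLaw : HasLaw (fun ω (p : Fin n × Fin d × Fin 4) => coords (α p.1 ω p.2.1) p.2.2)
      (Measure.pi fun _ => gaussianReal 0 (1 / 4)) P :=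
    iIndepFun.hasLaw_pi (fun p => h.law p.1 p.2.1 p.2.2) h.indep
  refine ⟨joint_aemeasurable, Measure.ext_of_charFun (funext fun t => ?_)⟩
  have inner_coords (ω) : inner ℝ (WithLp.toLp 2 (α · ω)) t =
      inner ℝ (arrayCoords (α · ω)) (arrayCoords t) := by rw [inner_arrayCoords, PiLp.inner_apply]
  have norm_coords : ‖arrayCoords t‖ = ‖t‖ := by
    rw [norm_eq_sqrt_real_inner, norm_eq_sqrt_real_inner, inner_arrayCoords, PiLp.inner_apply]
  rw [charFun_halfGaussian, ← norm_coords, ← charFun_map_toLp_pi_gaussianReal, charFun_apply,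
    charFun_apply, integral_map joint_aemeasurable (Measurable.aestronglyMeasurable (by fun_prop)),
    integral_map (by fun_prop) (Measurable.aestronglyMeasurable (by fun_prop))]
  simp only [inner_coords]
  exact coords_hasLaw.integral_comp
    (f := fun f => Complex.exp (inner ℝ (WithLp.toLp 2 f) (arrayCoords t) * Complex.I))
    (Measurable.aestronglyMeasurable (by fun_prop))

theorem IsQuaternionGaussian.hasLaw (h : IsQuaternionGaussian P α) (k : Fin n) :
    HasLaw (α k) (halfGaussian (QVec d)) P where
  aemeasurable := h.aemeasurable k
  map_eq := by
    have eval_measurable : Measurable fun a : PiLp 2 (fun _ : Fin n => QVec d) => a k := by fun_prop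
    have map_eval : P.map (α k) =
        (halfGaussian (PiLp 2 fun _ : Fin n => QVec d)).map fun a => a k := by
      rw [← h.hasLaw_joint.map_eq, AEMeasurable.map_map_of_aemeasurable
        eval_measurable.aemeasurable h.hasLaw_joint.aemeasurable]
      rfl
    have := Measure.isProbabilityMeasure_map (h.aemeasurable k)
    refine Measure.ext_of_charFun (funext fun t => ?_)
    rw [map_eval, charFun_map_halfGaussian (g := PiLp.single 2 k) eval_measurable fun a t => ?_,
      PiLp.norm_single, charFun_halfGaussian]
    rw [PiLp.inner_apply a, Finset.sum_eq_single k (fun j _ hj => by simp [hj]) (by simp),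
      PiLp.single_eq_same]

theorem IsQuaternionGaussian.iIndepFun (h : IsQuaternionGaussian P α) :
    ProbabilityTheory.iIndepFun α P := by
  rw [iIndepFun_iff_charFun_pi h.aemeasurable]
  intro t
  rw [h.hasLaw_joint.map_eq, charFun_halfGaussian]
  simp only [(h.hasLaw _).map_eq, charFun_halfGaussian, ← Complex.exp_sum, ← Complex.ofReal_pow,
    PiLp.norm_sq_eq_of_L2]
  push_cast
  rw [← Finset.sum_neg_distrib, Finset.sum_div]

end JointLaw

section Marginals

variable {d : ℕ}

theorem real_inner_qInner (a h : QVec d) (t : ℍ[ℝ]) :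
    inner ℝ (qInner a h) t = inner ℝ a (rightMul h (star t)) := by
  rw [← re_qInner, qInner_rightMul_right, Quaternion.inner_def]

theorem measurable_qInner_left (h : QVec d) : Measurable fun a => qInner a h :=
  ((qInnerL d).flip h).continuous.measurable

theorem map_qInner_halfGaussian (h : QVec d) :
    (halfGaussian (QVec d)).map (fun a => qInner a h) = (halfGaussian ℍ[ℝ]).map (‖h‖ • ·) := by
  have := Measure.isProbabilityMeasure_map (μ := halfGaussian (QVec d))
    (measurable_qInner_left h).aemeasurable
  have : IsProbabilityMeasure ((halfGaussian ℍ[ℝ]).map (‖h‖ • ·)) :=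
    Measure.isProbabilityMeasure_map (by fun_prop)
  refine Measure.ext_of_charFun (funext fun t => ?_)
  rw [charFun_map_halfGaussian (measurable_qInner_left h) fun a t => real_inner_qInner a h t,
    charFun_map_smul, charFun_halfGaussian, norm_rightMul, norm_star, norm_smul, norm_norm]

theorem indepFun_qInner {x w : QVec d} (hxw : qInner x w = 0) :
    IndepFun (fun a => qInner a x) (fun a => qInner a w) (halfGaussian (QVec d)) := by
  have pair_measurable : Measurable fun a : QVec d => WithLp.toLp 2 (qInner a x, qInner a w) :=
    (WithLp.prod_continuous_toLp 2 _ _).measurable.comp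
      ((measurable_qInner_left x).prodMk (measurable_qInner_left w))
  have pair_adjoint (a : QVec d) (t : WithLp 2 (ℍ[ℝ] × ℍ[ℝ])) :
      inner ℝ (WithLp.toLp 2 (qInner a x, qInner a w)) t =
        inner ℝ a (rightMul x (star t.ofLp.1) + rightMul w (star t.ofLp.2)) := by
    simp only [WithLp.prod_inner_apply, real_inner_qInner, inner_add_right]
  have orthogonal (p q : ℍ[ℝ]) : inner ℝ (rightMul x p) (rightMul w q) = 0 := by
    rw [real_inner_rightMul_left, qInner_rightMul_right, hxw, zero_mul, inner_zero_right]
  rw [indepFun_iff_charFun_prod (measurable_qInner_left x).aemeasurable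
    (measurable_qInner_left w).aemeasurable]
  intro t
  rw [charFun_map_halfGaussian pair_measurable pair_adjoint,
    charFun_map_halfGaussian (measurable_qInner_left x) fun a t => real_inner_qInner a x t,
    charFun_map_halfGaussian (measurable_qInner_left w) fun a t => real_inner_qInner a w t,
    ← Complex.exp_add, ← Complex.ofReal_pow, norm_add_sq_real, orthogonal]
  congr 1
  push_cast
  ring

end Marginals

/-! ### Concentration of means of independent nonnegative variables -/

section Chernoff

theorem exp_mul_le_of_nonneg {C θ y : ℝ} (hC : 0 < C) (hθ : |θ| ≤ C / 2) (hy : 0 ≤ y) :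
    Real.exp (θ * y) ≤ 1 + θ * y + θ ^ 2 * (8 / C ^ 2 * Real.exp (C * y)) := by
  have taylor : Real.exp (θ * y) - 1 - θ * y ≤ (θ * y) ^ 2 * Real.exp |θ * y| := by
    have := Complex.norm_exp_sub_sum_le_norm_mul_exp (θ * y : ℝ) 2
    simp only [Finset.sum_range_succ, Finset.sum_range_zero, pow_zero, Nat.factorial_zero,
      Nat.cast_one, div_one, zero_add, pow_one, Nat.factorial_one, ← sub_sub] at this
    rw [← Complex.ofReal_exp, ← Complex.ofReal_one, ← Complex.ofReal_sub, ← Complex.ofReal_sub,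
      Complex.norm_real, Complex.norm_real, Real.norm_eq_abs, Real.norm_eq_abs, sq_abs] at this
    exact (le_abs_self _).trans this
  have exponent_le : |θ * y| ≤ C / 2 * y := by
    rw [abs_mul, abs_of_nonneg hy]; gcongr
  have sq_le : y ^ 2 ≤ 8 / C ^ 2 * Real.exp (C / 2 * y) := by
    have := Real.quadratic_le_exp_of_nonneg (show 0 ≤ C / 2 * y by positivity)
    rw [div_mul_eq_mul_div, le_div_iff₀ (by positivity)]
    nlinarith [show 0 ≤ C / 2 * y by positivity]
  have remainder : (θ * y) ^ 2 * Real.exp |θ * y| ≤ θ ^ 2 * (8 / C ^ 2 * Real.exp (C * y)) :=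
    calc (θ * y) ^ 2 * Real.exp |θ * y| ≤ (θ * y) ^ 2 * Real.exp (C / 2 * y) := by gcongr
      _ = θ ^ 2 * (y ^ 2 * Real.exp (C / 2 * y)) := by ring
      _ ≤ θ ^ 2 * (8 / C ^ 2 * Real.exp (C / 2 * y) * Real.exp (C / 2 * y)) := by gcongr
      _ = θ ^ 2 * (8 / C ^ 2 * Real.exp (C * y)) := by
        rw [mul_assoc (8 / C ^ 2), ← Real.exp_add]; ring_nf
  linarith

variable {Ω : Type*} [MeasurableSpace Ω] {P : Measure Ω} {C K θ m s : ℝ}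

/-- A nonnegative random variable whose exponential moment of order `C` is at most `K`. -/
structure HasExpMomentLE (Y : Ω → ℝ) (C K : ℝ) (P : Measure Ω) : Prop where
  aemeasurable : AEMeasurable Y P
  nonneg (ω : Ω) : 0 ≤ Y ω
  integrable_exp : Integrable (fun ω => Real.exp (C * Y ω)) P
  integral_exp_le : ∫ ω, Real.exp (C * Y ω) ∂P ≤ K

theorem HasExpMomentLE.integrable {Y : Ω → ℝ} (hY : HasExpMomentLE Y C K P) (hC : 0 < C) :
    Integrable Y P := by
  refine (hY.integrable_exp.const_mul C⁻¹).mono' hY.aemeasurable.aestronglyMeasurable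
    (.of_forall fun ω => ?_)
  rw [Real.norm_eq_abs, abs_of_nonneg (hY.nonneg ω), le_inv_mul_iff₀ hC]
  linarith [Real.add_one_le_exp (C * Y ω)]

theorem HasExpMomentLE.integrable_exp_mul [IsFiniteMeasure P] {Y : Ω → ℝ}
    (hY : HasExpMomentLE Y C K P) (hC : 0 < C) (hθ : |θ| ≤ C / 2) :
    Integrable (fun ω => Real.exp (θ * Y ω)) P := by
  refine (((integrable_const 1).add ((hY.integrable hC).const_mul θ)).add
    ((hY.integrable_exp.const_mul (8 / C ^ 2)).const_mul (θ ^ 2))).mono'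
    (hY.aemeasurable.const_mul θ).exp.aestronglyMeasurable (.of_forall fun ω => ?_)
  rw [Real.norm_eq_abs, abs_of_pos (Real.exp_pos _)]
  exact exp_mul_le_of_nonneg hC hθ (hY.nonneg ω)

variable [IsProbabilityMeasure P]

theorem HasExpMomentLE.mgf_le {Y : Ω → ℝ} (hY : HasExpMomentLE Y C K P) (hC : 0 < C)
    (hθ : |θ| ≤ C / 2) :
    mgf Y P θ ≤ Real.exp (θ * (∫ ω, Y ω ∂P) + θ ^ 2 * (8 / C ^ 2 * K)) := by
  have linear_integrable : Integrable (fun ω => 1 + θ * Y ω) P :=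
    (integrable_const 1).add ((hY.integrable hC).const_mul θ)
  have remainder_integrable :
      Integrable (fun ω => θ ^ 2 * (8 / C ^ 2 * Real.exp (C * Y ω))) P :=
    (hY.integrable_exp.const_mul _).const_mul _
  calc mgf Y P θ ≤ ∫ ω, (1 + θ * Y ω + θ ^ 2 * (8 / C ^ 2 * Real.exp (C * Y ω))) ∂P :=
        integral_mono (hY.integrable_exp_mul hC hθ) (linear_integrable.add remainder_integrable)
          fun ω => exp_mul_le_of_nonneg hC hθ (hY.nonneg ω)
    _ = 1 + θ * (∫ ω, Y ω ∂P) + θ ^ 2 * (8 / C ^ 2 * ∫ ω, Real.exp (C * Y ω) ∂P) := by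
        rw [integral_add linear_integrable remainder_integrable,
          integral_add (integrable_const 1) ((hY.integrable hC).const_mul θ),
          integral_const_mul, integral_const_mul, integral_const_mul]
        simp
    _ ≤ 1 + θ * (∫ ω, Y ω ∂P) + θ ^ 2 * (8 / C ^ 2 * K) := by gcongr; exact hY.integral_exp_le
    _ ≤ _ := by linarith [Real.add_one_le_exp (θ * (∫ ω, Y ω ∂P) + θ ^ 2 * (8 / C ^ 2 * K))]

theorem measureReal_mul_expect_sub_ge_le {n : ℕ} {Y : Fin n → Ω → ℝ} (hC : 0 < C)
    (hY : ∀ k, HasExpMomentLE (Y k) C K P) (hindep : iIndepFun Y P)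
    (hmean : ∀ k, ∫ ω, Y k ω ∂P = m) (hθ : |θ| ≤ C / 2) :
    P.real {ω | s ≤ θ * (𝔼 k, Y k ω - m)} ≤
      Real.exp (-(n * (s - θ ^ 2 * (8 / C ^ 2 * K)))) := by
  have mgf_sum : mgf (∑ k, Y k) P θ = ∏ k, mgf (Y k) P θ :=
    hindep.mgf_sum₀ (fun k => (hY k).aemeasurable) _
  have mgf_sum_le : mgf (∑ k, Y k) P θ ≤ Real.exp (n * (θ * m + θ ^ 2 * (8 / C ^ 2 * K))) :=
    calc mgf (∑ k, Y k) P θ ≤ ∏ _k : Fin n, Real.exp (θ * m + θ ^ 2 * (8 / C ^ 2 * K)) := by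
          rw [mgf_sum]
          exact Finset.prod_le_prod (fun k _ => mgf_nonneg) fun k _ => hmean k ▸ (hY k).mgf_le hC hθ
      _ = _ := by simp [← Real.exp_nat_mul]
  have sum_integrable : Integrable (fun ω => Real.exp (1 * (θ * (∑ k, Y k) ω))) P := by
    simp only [one_mul]
    refine not_imp_comm.1 mgf_undef (mgf_sum ▸ (Finset.prod_pos fun k _ => ?_).ne')
    exact mgf_pos ((hY k).integrable_exp_mul hC hθ)
  calc P.real {ω | s ≤ θ * (𝔼 k, Y k ω - m)}
      ≤ P.real {ω | n * (s + θ * m) ≤ θ * (∑ k, Y k) ω} := by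
        refine measureReal_mono fun ω hω => ?_
        have sum_eq : (∑ k, Y k) ω = n * 𝔼 k, Y k ω := by
          rw [Finset.sum_apply, ← Fintype.card_mul_expect, Fintype.card_fin]
        have := mul_le_mul_of_nonneg_left (Set.mem_ofPred_eq ▸ hω) n.cast_nonneg (α := ℝ)
        simp only [Set.mem_ofPred_eq, sum_eq]
        linarith
    _ ≤ Real.exp (-1 * (n * (s + θ * m))) * mgf (fun ω => θ * (∑ k, Y k) ω) P 1 :=
        measure_ge_le_exp_mul_mgf _ zero_le_one sum_integrable
    _ ≤ Real.exp (-1 * (n * (s + θ * m))) *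
          Real.exp (n * (θ * m + θ ^ 2 * (8 / C ^ 2 * K))) := by
        rw [mgf_const_mul, mul_one]; gcongr
    _ = _ := by rw [← Real.exp_add]; ring_nf

theorem measure_abs_expect_sub_gt_le {δ : ℝ} (hC : 0 < C) (hK : 0 < K) (hδ : 0 < δ) :
    ∃ c : ℝ, 0 < c ∧ ∀ {Ω : Type*} [MeasurableSpace Ω] (P : Measure Ω) [IsProbabilityMeasure P]
      (n : ℕ) (Y : Fin n → Ω → ℝ) (m : ℝ), (∀ k, HasExpMomentLE (Y k) C K P) → iIndepFun Y P →
      (∀ k, ∫ ω, Y k ω ∂P = m) →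
      P {ω | δ < |𝔼 k, Y k ω - m|} ≤ ENNReal.ofReal (2 * Real.exp (-(c * n))) := by
  set V := 8 / C ^ 2 * K
  have hV : 0 < V := by positivity
  set θ := min (C / 2) (δ / (2 * V))
  have hθ : 0 < θ := lt_min (by positivity) (by positivity)
  have hθC : |θ| ≤ C / 2 := by rw [abs_of_pos hθ]; exact min_le_left _ _
  have hθV : θ * V ≤ δ / 2 := by
    calc θ * V ≤ δ / (2 * V) * V := by gcongr; exact min_le_right _ _
      _ = δ / 2 := by field_simp
  refine ⟨θ * δ / 2, by positivity, fun P _ n Y m hY hindep hmean => ?_⟩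
  have exponent_le : -((n : ℝ) * (θ * δ - θ ^ 2 * V)) ≤ -(θ * δ / 2 * n) := by
    have : (n : ℝ) * (θ * (θ * V)) ≤ n * (θ * (δ / 2)) := by gcongr
    linarith
  have upper := measureReal_mul_expect_sub_ge_le (s := θ * δ) hC hY hindep hmean hθC
  have lower := measureReal_mul_expect_sub_ge_le (s := θ * δ) hC hY hindep hmean
    ((abs_neg θ).trans_le hθC)
  rw [neg_sq] at lower
  rw [← ofReal_measureReal]
  refine ENNReal.ofReal_le_ofReal ?_
  calc P.real {ω | δ < |𝔼 k, Y k ω - m|}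
      ≤ P.real ({ω | θ * δ ≤ θ * (𝔼 k, Y k ω - m)} ∪ {ω | θ * δ ≤ -θ * (𝔼 k, Y k ω - m)}) := by
        refine measureReal_mono fun ω hω => ?_
        rcases lt_abs.1 (Set.mem_ofPred_eq ▸ hω) with h | h
        · exact .inl (mul_le_mul_of_nonneg_left h.le hθ.le)
        · exact .inr ((mul_le_mul_of_nonneg_left h.le hθ.le).trans_eq (by ring))
    _ ≤ _ := measureReal_union_le _ _
    _ ≤ Real.exp (-(θ * δ / 2 * n)) + Real.exp (-(θ * δ / 2 * n)) :=
        add_le_add (upper.trans (Real.exp_le_exp.2 exponent_le))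
          (lower.trans (Real.exp_le_exp.2 exponent_le))
    _ = 2 * Real.exp (-(θ * δ / 2 * n)) := (two_mul _).symm

end Chernoff

/-! ### Nets of subsets of the unit ball -/

section Nets

open Metric NNReal

variable {E : Type*} [NormedAddCommGroup E] [NormedSpace ℝ E] [FiniteDimensional ℝ E] {ε : ℝ≥0}

theorem card_le_of_isSeparated (hε : 0 < ε) (hε1 : ε ≤ 1) {s : Finset E}
    (hs : (s : Set E) ⊆ closedBall 0 1) (hsep : IsSeparated ε (s : Set E)) :
    (s.card : ℝ) ≤ (3 / ε) ^ Module.finrank ℝ E := by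
  borelize E
  let μ : Measure E := Measure.addHaar
  have hε' : (0 : ℝ) < ε / 2 := by positivity
  have balls_disjoint : (s : Set E).PairwiseDisjoint fun c => ball c (ε / 2 : ℝ) := by
    intro c hc y hy hcy
    refine ball_disjoint_ball ?_
    have : ε < nndist c y := ENNReal.coe_lt_coe.1 (edist_nndist c y ▸ hsep hc hy hcy)
    rw [dist_nndist, add_halves]
    exact this.le
  have balls_subset : (⋃ c ∈ s, ball c (ε / 2 : ℝ)) ⊆ ball (0 : E) (3 / 2) := by
    refine Set.iUnion₂_subset fun c hc => ball_subset_ball' ?_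
    have : dist c 0 ≤ 1 := hs hc
    have : (ε : ℝ) ≤ 1 := hε1
    linarith
  have volume_le : s.card * ENNReal.ofReal ((ε / 2 : ℝ) ^ Module.finrank ℝ E) * μ (ball 0 1) ≤
      ENNReal.ofReal ((3 / 2) ^ Module.finrank ℝ E) * μ (ball 0 1) :=
    calc s.card * ENNReal.ofReal ((ε / 2 : ℝ) ^ Module.finrank ℝ E) * μ (ball 0 1)
        = μ (⋃ c ∈ s, ball c (ε / 2 : ℝ)) := by
          rw [measure_biUnion_finset balls_disjoint fun c _ => measurableSet_ball]
          simp only [μ.addHaar_ball_of_pos _ hε', Finset.sum_const, nsmul_eq_mul, mul_assoc]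
      _ ≤ μ (ball (0 : E) (3 / 2)) := measure_mono balls_subset
      _ = _ := μ.addHaar_ball_of_pos _ (by norm_num)
  have card_mul_le := ENNReal.toReal_le_of_le_ofReal (by positivity)
    ((ENNReal.mul_le_mul_iff_left (measure_ball_pos _ _ zero_lt_one).ne' measure_ball_lt_top.ne).1
      volume_le)
  rw [ENNReal.toReal_mul, ENNReal.toReal_natCast, ENNReal.toReal_ofReal (by positivity)]
    at card_mul_le
  calc (s.card : ℝ) ≤ (3 / 2) ^ Module.finrank ℝ E / (ε / 2) ^ Module.finrank ℝ E :=
        (le_div_iff₀ (by positivity)).2 card_mul_le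
    _ = (3 / ε) ^ Module.finrank ℝ E := by rw [← div_pow]; congr 1; field_simp

theorem exists_isCover_card_le (hε : 0 < ε) (hε1 : ε ≤ 1) {S : Set E} (hS : S ⊆ closedBall 0 1) :
    ∃ t : Finset E, (t : Set E) ⊆ S ∧ IsCover ε S (t : Set E) ∧
      (t.card : ℝ) ≤ (3 / ε) ^ Module.finrank ℝ E := by
  have : ProperSpace E := FiniteDimensional.proper ℝ E
  obtain ⟨N, _, hN, hcover⟩ := exists_finite_isCover_of_isCompact_closure (half_pos hε).ne'
    ((isCompact_closedBall (0 : E) 1).closure_of_subset hS)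
  have packing_ne_top : packingNumber ε S ≠ ⊤ := by
    refine ne_top_of_le_ne_top hN.encard_lt_top.ne (le_trans ?_
      hcover.externalCoveringNumber_le_encard)
    simpa [mul_div_cancel₀] using packingNumber_two_mul_le_externalCoveringNumber (ε / 2) S
  have finite : (maximalSeparatedSet ε S).Finite := by
    rw [← Set.encard_ne_top_iff, encard_maximalSeparatedSet packing_ne_top]
    exact packing_ne_top
  have subset : (finite.toFinset : Set E) ⊆ S :=
    finite.coe_toFinset.trans_subset maximalSeparatedSet_subset
  refine ⟨finite.toFinset, subset, ?_,
    card_le_of_isSeparated hε hε1 (subset.trans hS) ?_⟩ <;> rw [finite.coe_toFinset]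
  · exact isCover_maximalSeparatedSet packing_ne_top
  · exact isSeparated_maximalSeparatedSet

end Nets

/-! ### Moments of quaternionic Gaussian vectors -/

section Moments

variable {E : Type*} [NormedAddCommGroup E] [InnerProductSpace ℝ E] [FiniteDimensional ℝ E]
  [MeasurableSpace E] [BorelSpace E]

instance : IsGaussian (halfGaussian E) :=
  inferInstanceAs (IsGaussian ((stdGaussian E).map ((1 / 2 : ℝ) • ContinuousLinearMap.id ℝ E)))

theorem integral_inner_halfGaussian (s : E) : ∫ z, inner ℝ s z ∂(halfGaussian E) = 0 := by
  have integral_std : ∫ z, inner ℝ s z ∂(stdGaussian E) = 0 :=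
    integral_strongDual_stdGaussian (innerSL ℝ s)
  rw [halfGaussian, integral_map (by fun_prop) (Measurable.aestronglyMeasurable (by fun_prop))]
  simp only [real_inner_smul_right]
  rw [integral_const_mul, integral_std, mul_zero]

theorem integral_inner_sq_halfGaussian (s : E) :
    ∫ z, inner ℝ s z ^ 2 ∂(halfGaussian E) = ‖s‖ ^ 2 / 4 := by
  have integral_std : ∫ z, inner ℝ s z ^ 2 ∂(stdGaussian E) = ‖s‖ ^ 2 := by
    have variance := variance_dual_stdGaussian (innerSL ℝ s)
    rw [variance_eq_integral (by fun_prop), integral_strongDual_stdGaussian] at variance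
    simpa using variance
  rw [halfGaussian, integral_map (by fun_prop) (Measurable.aestronglyMeasurable (by fun_prop))]
  simp only [real_inner_smul_right, mul_pow]
  rw [integral_const_mul, integral_std]
  ring

theorem integrable_norm_pow_halfGaussian (p : ℕ) :
    Integrable (fun z => ‖z‖ ^ p) (halfGaussian E) :=
  (IsGaussian.memLp_id (halfGaussian E) p (by simp)).integrable_norm_pow'

theorem integrable_inner_halfGaussian (s : E) :
    Integrable (fun z => inner ℝ s z) (halfGaussian E) := by
  refine ((integrable_norm_pow_halfGaussian 1).const_mul ‖s‖).mono'
    (Measurable.aestronglyMeasurable (by fun_prop)) (.of_forall fun z => ?_)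
  simpa only [pow_one] using norm_inner_le_norm s z

theorem integrable_inner_sq_halfGaussian (s : E) :
    Integrable (fun z => inner ℝ s z ^ 2) (halfGaussian E) := by
  refine ((integrable_norm_pow_halfGaussian 2).const_mul (‖s‖ ^ 2)).mono'
    (Measurable.aestronglyMeasurable (by fun_prop)) (.of_forall fun z => ?_)
  rw [norm_pow, ← mul_pow]
  gcongr
  exact norm_inner_le_norm s z

theorem integral_norm_sq_halfGaussian :
    ∫ z, ‖z‖ ^ 2 ∂(halfGaussian E) = Module.finrank ℝ E / 4 := by
  simp only [← (stdOrthonormalBasis ℝ E).sum_sq_inner_right]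
  rw [integral_finsetSum _ fun i _ => integrable_inner_sq_halfGaussian _]
  simp [integral_inner_sq_halfGaussian, div_eq_mul_inv]

theorem integral_norm_sq_quaternion : ∫ q, ‖q‖ ^ 2 ∂(halfGaussian ℍ[ℝ]) = 1 := by
  rw [integral_norm_sq_halfGaussian, Quaternion.finrank_eq_four]; norm_num

variable {d : ℕ}

theorem integral_comp_qInner {F : ℍ[ℝ] → ℝ} (hF : Measurable F) (h : QVec d) :
    ∫ a, F (qInner a h) ∂(halfGaussian (QVec d)) = ∫ q, F (‖h‖ • q) ∂(halfGaussian ℍ[ℝ]) := by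
  rw [← integral_map (measurable_qInner_left h).aemeasurable hF.aestronglyMeasurable,
    map_qInner_halfGaussian, integral_map (by fun_prop) hF.aestronglyMeasurable]

theorem integrable_comp_qInner_iff {F : ℍ[ℝ] → ℝ} (hF : Measurable F) (h : QVec d) :
    Integrable (fun a => F (qInner a h)) (halfGaussian (QVec d)) ↔
      Integrable (fun q => F (‖h‖ • q)) (halfGaussian ℍ[ℝ]) := by
  rw [← Function.comp_def F, ← integrable_map_measure hF.aestronglyMeasurable
    (measurable_qInner_left h).aemeasurable, map_qInner_halfGaussian,
    integrable_map_measure hF.aestronglyMeasurable (by fun_prop)]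
  rfl

theorem integral_norm_qInner_sq (h : QVec d) :
    ∫ a, ‖qInner a h‖ ^ 2 ∂(halfGaussian (QVec d)) = ‖h‖ ^ 2 := by
  rw [integral_comp_qInner (F := fun q => ‖q‖ ^ 2) (by fun_prop)]
  simp only [norm_smul, norm_norm, mul_pow]
  rw [integral_const_mul, integral_norm_sq_quaternion, mul_one]

theorem integrable_norm_qInner_sq (h : QVec d) :
    Integrable (fun a => ‖qInner a h‖ ^ 2) (halfGaussian (QVec d)) := by
  rw [integrable_comp_qInner_iff (F := fun q => ‖q‖ ^ 2) (by fun_prop)]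
  simp only [norm_smul, norm_norm, mul_pow]
  exact (integrable_norm_pow_halfGaussian 2).const_mul _

theorem map_qInner_prodMk_halfGaussian {x w : QVec d} (hx : ‖x‖ = 1) (hxw : qInner x w = 0) :
    (halfGaussian (QVec d)).map (fun a => (qInner a x, qInner a w)) =
      (halfGaussian ℍ[ℝ]).prod ((halfGaussian ℍ[ℝ]).map (‖w‖ • ·)) := by
  rw [(indepFun_iff_map_prod_eq_prod_map_map (measurable_qInner_left x).aemeasurable
    (measurable_qInner_left w).aemeasurable).1 (indepFun_qInner hxw), map_qInner_halfGaussian,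
    map_qInner_halfGaussian, hx]
  simp only [one_smul, Measure.map_id']

theorem integral_comp_qInner_prod {F : ℍ[ℝ] × ℍ[ℝ] → ℝ} (hF : Measurable F) {x w : QVec d}
    (hx : ‖x‖ = 1) (hxw : qInner x w = 0)
    (h_int : Integrable (fun a => F (qInner a x, qInner a w)) (halfGaussian (QVec d))) :
    ∫ a, F (qInner a x, qInner a w) ∂(halfGaussian (QVec d)) =
      ∫ u, ∫ q, F (u, ‖w‖ • q) ∂(halfGaussian ℍ[ℝ]) ∂(halfGaussian ℍ[ℝ]) := by
  have pair_aemeasurable :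
      AEMeasurable (fun a => (qInner a x, qInner a w)) (halfGaussian (QVec d)) :=
    ((measurable_qInner_left x).prodMk (measurable_qInner_left w)).aemeasurable
  have prod_integrable :
      Integrable F ((halfGaussian ℍ[ℝ]).prod ((halfGaussian ℍ[ℝ]).map (‖w‖ • ·))) := by
    rwa [← map_qInner_prodMk_halfGaussian hx hxw,
      integrable_map_measure hF.aestronglyMeasurable pair_aemeasurable]
  have : IsProbabilityMeasure ((halfGaussian ℍ[ℝ]).map (‖w‖ • ·)) :=
    Measure.isProbabilityMeasure_map (by fun_prop)
  rw [← integral_map pair_aemeasurable hF.aestronglyMeasurable,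
    map_qInner_prodMk_halfGaussian hx hxw, integral_prod _ prod_integrable]
  refine integral_congr_ae (.of_forall fun u => ?_)
  exact integral_map (by fun_prop) (Measurable.aestronglyMeasurable (by fun_prop))

end Moments

/-! ### Events of overwhelming probability -/

section Probability

universe u

/-- The event `Q d n x` about the measurement vectors fails with probability at most
`c₁ e^{-c₂ n}`, uniformly over the nonzero signals `x ∈ ℍ^d` and over the sample sizes `n ≥ C d`. -/
def HoldsWHP (Q : ∀ d n : ℕ, QVec d → (Fin n → QVec d) → Prop) : Prop :=
  ∃ C c₁ c₂ : ℝ, 0 < C ∧ 0 < c₁ ∧ 0 < c₂ ∧ ∀ (d n : ℕ) (x : QVec d), x ≠ 0 →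
    C * (d : ℝ) ≤ (n : ℝ) → ∀ (Ω : Type u) [MeasurableSpace Ω] (P : Measure Ω)
    [IsProbabilityMeasure P] (α : Fin n → Ω → QVec d), IsQuaternionGaussian P α →
    P {ω | ¬ Q d n x (fun k => α k ω)} ≤ ENNReal.ofReal (c₁ * Real.exp (-(c₂ * n)))

variable {Q R : ∀ d n : ℕ, QVec d → (Fin n → QVec d) → Prop}

theorem HoldsWHP.mono (hQ : HoldsWHP.{u} Q)
    (h : ∀ d n (x : QVec d) (A : Fin n → QVec d), x ≠ 0 → Q d n x A → R d n x A) :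
    HoldsWHP.{u} R := by
  obtain ⟨C, c₁, c₂, hC, hc₁, hc₂, H⟩ := hQ
  refine ⟨C, c₁, c₂, hC, hc₁, hc₂, fun d n x hx hdn Ω _ P _ α hα => ?_⟩
  exact (measure_mono fun ω => mt (h d n x _ hx)).trans (H d n x hx hdn Ω P α hα)

theorem HoldsWHP.and (hQ : HoldsWHP.{u} Q) (hR : HoldsWHP.{u} R) :
    HoldsWHP.{u} fun d n x A => Q d n x A ∧ R d n x A := by
  obtain ⟨C, c₁, c₂, hC, hc₁, hc₂, H⟩ := hQ
  obtain ⟨C', c₁', c₂', _, hc₁', hc₂', H'⟩ := hR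
  refine ⟨max C C', c₁ + c₁', min c₂ c₂', by positivity, by positivity, lt_min hc₂ hc₂',
    fun d n x hx hdn Ω _ P _ α hα => ?_⟩
  rw [max_mul_of_nonneg _ _ d.cast_nonneg, max_le_iff] at hdn
  calc P {ω | ¬ (Q d n x (fun k => α k ω) ∧ R d n x fun k => α k ω)}
      ≤ P ({ω | ¬ Q d n x fun k => α k ω} ∪ {ω | ¬ R d n x fun k => α k ω}) :=
        measure_mono fun ω => not_and_or.1
    _ ≤ ENNReal.ofReal (c₁ * Real.exp (-(c₂ * n))) +
          ENNReal.ofReal (c₁' * Real.exp (-(c₂' * n))) :=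
        (measure_union_le _ _).trans
          (add_le_add (H d n x hx hdn.1 Ω P α hα) (H' d n x hx hdn.2 Ω P α hα))
    _ = ENNReal.ofReal (c₁ * Real.exp (-(c₂ * n)) + c₁' * Real.exp (-(c₂' * n))) :=
        (ENNReal.ofReal_add (by positivity) (by positivity)).symm
    _ ≤ ENNReal.ofReal ((c₁ + c₁') * Real.exp (-(min c₂ c₂' * n))) := by
        rw [add_mul]
        gcongr
        exacts [min_le_left _ _, min_le_right _ _]

theorem IsQuaternionGaussian.hasExpMomentLE {d n : ℕ} {Ω : Type*} [MeasurableSpace Ω]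
    {P : Measure Ω} [IsProbabilityMeasure P] {α : Fin n → Ω → QVec d}
    (hα : IsQuaternionGaussian P α) {C : ℝ} (hC : 0 ≤ C)
    (h_int : Integrable (fun q => Real.exp (C * ‖q‖ ^ 2)) (halfGaussian ℍ[ℝ])) {F : QVec d → ℝ}
    {h : QVec d} (hF : Measurable F) (hF0 : ∀ a, 0 ≤ F a) (hFle : ∀ a, F a ≤ ‖qInner a h‖ ^ 2)
    (hh : ‖h‖ = 1) (k : Fin n) :
    HasExpMomentLE (fun ω => F (α k ω)) C
      (∫ q, Real.exp (C * ‖q‖ ^ 2) ∂(halfGaussian ℍ[ℝ])) P := by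
  have exp_measurable : Measurable fun a => Real.exp (C * F a) := by fun_prop
  have dominating_integrable :
      Integrable (fun a => Real.exp (C * ‖qInner a h‖ ^ 2)) (halfGaussian (QVec d)) := by
    rw [integrable_comp_qInner_iff (F := fun q => Real.exp (C * ‖q‖ ^ 2)) (by fun_prop), hh]
    simpa only [one_smul] using h_int
  have exp_le (a : QVec d) : Real.exp (C * F a) ≤ Real.exp (C * ‖qInner a h‖ ^ 2) := by
    gcongr; exact hFle a
  have exp_integrable : Integrable (fun a => Real.exp (C * F a)) (halfGaussian (QVec d)) :=
    dominating_integrable.mono' exp_measurable.aestronglyMeasurable (.of_forall fun a => by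
      rw [Real.norm_eq_abs, Real.abs_exp]; exact exp_le a)
  refine ⟨hF.comp_aemeasurable (hα.aemeasurable k), fun ω => hF0 _, ?_, ?_⟩
  · rwa [← (hα.hasLaw k).map_eq, integrable_map_measure exp_measurable.aestronglyMeasurable
      (hα.aemeasurable k)] at exp_integrable
  · calc ∫ ω, Real.exp (C * F (α k ω)) ∂P
        = ∫ a, Real.exp (C * F a) ∂(halfGaussian (QVec d)) :=
          (hα.hasLaw k).integral_comp exp_measurable.aestronglyMeasurable
      _ ≤ ∫ a, Real.exp (C * ‖qInner a h‖ ^ 2) ∂(halfGaussian (QVec d)) :=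
          integral_mono exp_integrable dominating_integrable exp_le
      _ = ∫ q, Real.exp (C * ‖q‖ ^ 2) ∂(halfGaussian ℍ[ℝ]) := by
          rw [integral_comp_qInner (F := fun q => Real.exp (C * ‖q‖ ^ 2)) (by fun_prop), hh]
          simp only [one_smul]

theorem exists_measure_abs_expect_sub_integral_gt_le {δ : ℝ} (hδ : 0 < δ) :
    ∃ c : ℝ, 0 < c ∧ ∀ {d n : ℕ} {Ω : Type u} [MeasurableSpace Ω] {P : Measure Ω}
      [IsProbabilityMeasure P] {α : Fin n → Ω → QVec d}, IsQuaternionGaussian P α →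
      ∀ {F : QVec d → ℝ} {h : QVec d}, Measurable F → (∀ a, 0 ≤ F a) →
      (∀ a, F a ≤ ‖qInner a h‖ ^ 2) → ‖h‖ = 1 →
      P {ω | δ < |𝔼 k, F (α k ω) - ∫ a, F a ∂(halfGaussian (QVec d))|}
        ≤ ENNReal.ofReal (2 * Real.exp (-(c * n))) := by
  obtain ⟨C, hC, h_int⟩ := IsGaussian.exists_integrable_exp_sq (halfGaussian ℍ[ℝ])
  obtain ⟨c, hc, concentration⟩ :=
    measure_abs_expect_sub_gt_le.{u} hC (integral_exp_pos h_int) hδ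
  refine ⟨c, hc, fun {d n Ω _ P _ α} hα F h hF hF0 hFle hh => concentration P n _ _
    (hα.hasExpMomentLE hC.le h_int hF hF0 hFle hh)
    (hα.iIndepFun.comp (fun _ => F) fun _ => hF)
    fun k => (hα.hasLaw k).integral_comp hF.aestronglyMeasurable⟩

theorem holdsWHP_forall_mem_finset {B δ : ℝ} (hB : 1 < B) (hδ : 0 < δ)
    {t : ∀ d, Finset (QVec d)} (ht : ∀ d, ∀ y ∈ t d, ‖y‖ = 1)
    (htB : ∀ d, ((t d).card : ℝ) ≤ B ^ d) {F : ∀ d, QVec d → QVec d → QVec d → ℝ}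
    (hF : ∀ d x y, x ≠ 0 → Measurable fun a => F d x a y) (hF0 : ∀ d x a y, 0 ≤ F d x a y)
    (hFle : ∀ d x a y, x ≠ 0 → F d x a y ≤ ‖qInner a y‖ ^ 2) :
    HoldsWHP.{u} fun d _ x A =>
      ∀ y ∈ t d, |𝔼 k, F d x (A k) y - ∫ a, F d x a y ∂(halfGaussian (QVec d))| ≤ δ := by
  obtain ⟨c, hc, concentration⟩ := exists_measure_abs_expect_sub_integral_gt_le.{u} hδ
  have hlogB : 0 < Real.log B := Real.log_pos hB
  refine ⟨2 * Real.log B / c, 2, c / 2, by positivity, two_pos, half_pos hc,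
    fun d n x hx hdn Ω _ P _ α hα => ?_⟩
  have card_mul_le : (t d).card * Real.exp (-(c * n)) ≤ Real.exp (-(c / 2 * n)) :=
    calc (t d).card * Real.exp (-(c * n)) ≤ B ^ d * Real.exp (-(c * n)) := by
          gcongr; exact htB d
      _ = Real.exp (d * Real.log B + -(c * n)) := by
          rw [Real.exp_add, Real.exp_nat_mul, Real.exp_log (by positivity)]
      _ ≤ Real.exp (-(c / 2 * n)) := by
          rw [div_mul_eq_mul_div, div_le_iff₀ hc] at hdn
          gcongr
          linarith
  calc P {ω | ¬ ∀ y ∈ t d,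
          |𝔼 k, F d x (α k ω) y - ∫ a, F d x a y ∂(halfGaussian (QVec d))| ≤ δ}
      ≤ P (⋃ y ∈ t d,
          {ω | δ < |𝔼 k, F d x (α k ω) y - ∫ a, F d x a y ∂(halfGaussian (QVec d))|}) := by
        refine measure_mono fun ω hω => ?_
        simpa using hω
    _ ≤ ∑ y ∈ t d, ENNReal.ofReal (2 * Real.exp (-(c * n))) :=
        (measure_biUnion_finset_le _ _).trans (Finset.sum_le_sum fun y hy =>
          concentration (F := fun a => F d x a y) (h := y) hα (hF d x y hx)
            (fun a => hF0 d x a y) (fun a => hFle d x a y hx) (ht d y hy))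
    _ = ENNReal.ofReal (2 * ((t d).card * Real.exp (-(c * n)))) := by
        rw [Finset.sum_const, nsmul_eq_mul, mul_left_comm 2,
          ENNReal.ofReal_mul (Nat.cast_nonneg _), ENNReal.ofReal_natCast]
    _ ≤ ENNReal.ofReal (2 * Real.exp (-(c / 2 * n))) := by gcongr

end Probability

/-! ### Uniform concentration on the unit sphere -/

section UniformConcentration

universe u

variable {d n : ℕ}

theorem le_mul_norm_sq_of_homogeneous {E : Type*} [NormedAddCommGroup E] [NormedSpace ℝ E]
    {f : E → ℝ} {c : ℝ} (hf : ∀ (r : ℝ) h, f (r • h) = r ^ 2 * f h)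
    (hc : ∀ h, ‖h‖ = 1 → f h ≤ c) (h : E) : f h ≤ c * ‖h‖ ^ 2 := by
  rcases eq_or_ne h 0 with rfl | hh
  · simpa using (hf 0 0).le
  · have norm_ne : ‖h‖ ≠ 0 := norm_ne_zero_iff.2 hh
    have unit_le := hc (‖h‖⁻¹ • h) (by simp [norm_smul, norm_ne])
    rwa [hf, inv_pow, inv_mul_le_iff₀ (by positivity), mul_comm] at unit_le

theorem expect_norm_qInner_smul_sq (A : Fin n → QVec d) (r : ℝ) (h : QVec d) :
    𝔼 k, ‖qInner (A k) (r • h)‖ ^ 2 = r ^ 2 * 𝔼 k, ‖qInner (A k) h‖ ^ 2 := by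
  simp only [qInner_smul_right, norm_smul, mul_pow, Real.norm_eq_abs, sq_abs, Finset.mul_expect]

theorem expect_norm_qInner_add_sq_le (A : Fin n → QVec d) (y z : QVec d) :
    𝔼 k, ‖qInner (A k) (y + z)‖ ^ 2 ≤
      2 * (𝔼 k, ‖qInner (A k) y‖ ^ 2 + 𝔼 k, ‖qInner (A k) z‖ ^ 2) := by
  rw [← Finset.expect_add_distrib, Finset.mul_expect]
  refine Finset.expect_le_expect fun k _ => ?_
  rw [qInner_add_right]
  calc ‖qInner (A k) y + qInner (A k) z‖ ^ 2 ≤ (‖qInner (A k) y‖ + ‖qInner (A k) z‖) ^ 2 := by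
        gcongr; exact norm_add_le _ _
    _ ≤ _ := add_sq_le

theorem expect_norm_qInner_sq_le_of_net {A : Fin n → QVec d} {t : Set (QVec d)}
    (hnet : ∀ h : QVec d, ‖h‖ = 1 → ∃ y ∈ t, ‖h - y‖ ≤ 1 / 4)
    (ht : ∀ y ∈ t, 𝔼 k, ‖qInner (A k) y‖ ^ 2 ≤ 2) (h : QVec d) :
    𝔼 k, ‖qInner (A k) h‖ ^ 2 ≤ 5 * ‖h‖ ^ 2 := by
  have : ProperSpace (QVec d) := FiniteDimensional.proper ℝ _
  refine le_mul_norm_sq_of_homogeneous (f := fun h => 𝔼 k, ‖qInner (A k) h‖ ^ 2)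
    (expect_norm_qInner_smul_sq A) (fun z hz => ?_) h
  have continuous : Continuous fun h => 𝔼 k, ‖qInner (A k) h‖ ^ 2 := by
    simp only [Fintype.expect_eq_sum_div_card]
    exact (continuous_finsetSum _ fun k _ =>
      ((qInnerL d (A k)).continuous.norm).pow 2).div_const _
  obtain ⟨v, hv, hmax⟩ := (isCompact_sphere (0 : QVec d) 1).exists_isMaxOn
    ⟨z, by simpa using hz⟩ continuous.continuousOn
  obtain ⟨y, hy, hvy⟩ := hnet v (by simpa using hv)
  have remainder_le : 𝔼 k, ‖qInner (A k) (v - y)‖ ^ 2 ≤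
      (𝔼 k, ‖qInner (A k) v‖ ^ 2) * ‖v - y‖ ^ 2 :=
    le_mul_norm_sq_of_homogeneous (f := fun h => 𝔼 k, ‖qInner (A k) h‖ ^ 2)
      (expect_norm_qInner_smul_sq A) (fun w hw => hmax (by simpa using hw)) _
  have max_le : 𝔼 k, ‖qInner (A k) v‖ ^ 2 ≤
      2 * (2 + (𝔼 k, ‖qInner (A k) v‖ ^ 2) * (1 / 4) ^ 2) :=
    calc 𝔼 k, ‖qInner (A k) v‖ ^ 2 = 𝔼 k, ‖qInner (A k) (y + (v - y))‖ ^ 2 := by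
          rw [add_sub_cancel]
      _ ≤ _ := expect_norm_qInner_add_sq_le A y (v - y)
      _ ≤ 2 * (2 + (𝔼 k, ‖qInner (A k) v‖ ^ 2) * ‖v - y‖ ^ 2) := by gcongr; exact ht y hy
      _ ≤ _ := by gcongr
  have z_le : 𝔼 k, ‖qInner (A k) z‖ ^ 2 ≤ 𝔼 k, ‖qInner (A k) v‖ ^ 2 := hmax (by simpa using hz)
  linarith

/-- A function of a measurement vector `a` and a direction `h` that is measurable in `a`, vanishes
at `h = 0` and is `1`-Lipschitz in `h` for the seminorm `|a^* h|`. -/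
structure IsInnerLipschitz (G : QVec d → QVec d → ℝ) : Prop where
  measurable (h : QVec d) : Measurable fun a => G a h
  map_zero (a : QVec d) : G a 0 = 0
  abs_sub_le (a h y : QVec d) : |G a h - G a y| ≤ ‖qInner a (h - y)‖

namespace IsInnerLipschitz

variable {G : QVec d → QVec d → ℝ}

theorem abs_le (hG : IsInnerLipschitz G) (a h : QVec d) : |G a h| ≤ ‖qInner a h‖ := by
  simpa only [hG.map_zero, sub_zero] using hG.abs_sub_le a h 0

theorem sq_le (hG : IsInnerLipschitz G) (a h : QVec d) : G a h ^ 2 ≤ ‖qInner a h‖ ^ 2 := by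
  rw [← sq_abs]; gcongr; exact hG.abs_le a h

theorem integrable_sq (hG : IsInnerLipschitz G) (h : QVec d) :
    Integrable (fun a => G a h ^ 2) (halfGaussian (QVec d)) :=
  (integrable_norm_qInner_sq h).mono' ((hG.measurable h).pow_const 2).aestronglyMeasurable
    (.of_forall fun a => by rw [norm_pow, Real.norm_eq_abs, sq_abs]; exact hG.sq_le a h)

theorem abs_sq_sub_sq_le (hG : IsInnerLipschitz G) {ε : ℝ} (hε : 0 < ε) (a h y : QVec d) :
    |G a h ^ 2 - G a y ^ 2| ≤
      ‖qInner a (h - y)‖ ^ 2 / (2 * ε) + ε * (‖qInner a h‖ ^ 2 + ‖qInner a y‖ ^ 2) := by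
  have young (b s s' : ℝ) : b * (s + s') ≤ b ^ 2 / (2 * ε) + ε * (s ^ 2 + s' ^ 2) := by
    rw [div_add' _ _ _ (by positivity), le_div_iff₀ (by positivity)]
    nlinarith [sq_nonneg (b - ε * (s + s')), sq_nonneg (ε * (s - s'))]
  refine le_trans ?_ (young _ _ _)
  rw [sq_sub_sq, abs_mul, mul_comm]
  gcongr
  · exact hG.abs_sub_le a h y
  · exact (abs_add_le _ _).trans (add_le_add (hG.abs_le a h) (hG.abs_le a y))

variable {ε : ℝ} {h y : QVec d}

theorem abs_expect_sq_sub_le (hG : IsInnerLipschitz G) (hε : 0 < ε) (hh : ‖h‖ = 1) (hy : ‖y‖ = 1)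
    (hhy : ‖h - y‖ ≤ ε) {A : Fin n → QVec d} (hA : ∀ h, 𝔼 k, ‖qInner (A k) h‖ ^ 2 ≤ 5 * ‖h‖ ^ 2) :
    |𝔼 k, G (A k) h ^ 2 - 𝔼 k, G (A k) y ^ 2| ≤ 25 / 2 * ε :=
  calc |𝔼 k, G (A k) h ^ 2 - 𝔼 k, G (A k) y ^ 2|
      ≤ 𝔼 k, (‖qInner (A k) (h - y)‖ ^ 2 / (2 * ε) +
          ε * (‖qInner (A k) h‖ ^ 2 + ‖qInner (A k) y‖ ^ 2)) := by
        rw [← Finset.expect_sub_distrib]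
        exact (Finset.abs_expect_le _ _).trans
          (Finset.expect_le_expect fun k _ => hG.abs_sq_sub_sq_le hε _ _ _)
    _ = (𝔼 k, ‖qInner (A k) (h - y)‖ ^ 2) / (2 * ε) +
          ε * (𝔼 k, ‖qInner (A k) h‖ ^ 2 + 𝔼 k, ‖qInner (A k) y‖ ^ 2) := by
        rw [Finset.expect_add_distrib, ← Finset.expect_div, ← Finset.mul_expect,
          Finset.expect_add_distrib]
    _ ≤ 5 * ε ^ 2 / (2 * ε) + ε * (5 * 1 ^ 2 + 5 * 1 ^ 2) := by
        gcongr
        · exact (hA _).trans (by gcongr)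
        · exact hh ▸ hA h
        · exact hy ▸ hA y
    _ = 25 / 2 * ε := by field_simp; ring

theorem abs_integral_sq_sub_le (hG : IsInnerLipschitz G) (hε : 0 < ε) (hh : ‖h‖ = 1)
    (hy : ‖y‖ = 1) (hhy : ‖h - y‖ ≤ ε) :
    |∫ a, G a h ^ 2 ∂(halfGaussian (QVec d)) - ∫ a, G a y ^ 2 ∂(halfGaussian (QVec d))| ≤
      5 / 2 * ε := by
  have quotient_integrable := (integrable_norm_qInner_sq (h - y)).div_const (2 * ε)
  have sum_integrable : Integrable (fun a => ε * (‖qInner a h‖ ^ 2 + ‖qInner a y‖ ^ 2))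
      (halfGaussian (QVec d)) :=
    ((integrable_norm_qInner_sq h).add (integrable_norm_qInner_sq y)).const_mul ε
  calc |∫ a, G a h ^ 2 ∂(halfGaussian (QVec d)) - ∫ a, G a y ^ 2 ∂(halfGaussian (QVec d))|
      ≤ ∫ a, |G a h ^ 2 - G a y ^ 2| ∂(halfGaussian (QVec d)) := by
        rw [← integral_sub (hG.integrable_sq h) (hG.integrable_sq y)]
        exact abs_integral_le_integral_abs
    _ ≤ ∫ a, (‖qInner a (h - y)‖ ^ 2 / (2 * ε) +
          ε * (‖qInner a h‖ ^ 2 + ‖qInner a y‖ ^ 2)) ∂(halfGaussian (QVec d)) :=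
        integral_mono ((hG.integrable_sq h).sub (hG.integrable_sq y)).abs
          (quotient_integrable.add sum_integrable) fun a => hG.abs_sq_sub_sq_le hε a h y
    _ = ‖h - y‖ ^ 2 / (2 * ε) + ε * (‖h‖ ^ 2 + ‖y‖ ^ 2) := by
        rw [integral_add quotient_integrable sum_integrable, integral_div, integral_const_mul,
          integral_add (integrable_norm_qInner_sq h) (integrable_norm_qInner_sq y)]
        simp only [integral_norm_qInner_sq]
    _ ≤ ε ^ 2 / (2 * ε) + ε * (1 ^ 2 + 1 ^ 2) := by rw [hh, hy]; gcongr
    _ = 5 / 2 * ε := by field_simp; ring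

end IsInnerLipschitz

theorem finrank_qVec (d : ℕ) : Module.finrank ℝ (QVec d) = 4 * d := by
  rw [(WithLp.linearEquiv 2 ℝ (Fin d → ℍ[ℝ])).finrank_eq, Module.finrank_pi_fintype]
  simp [Quaternion.finrank_eq_four, mul_comm]

theorem exists_sphere_net {ε : ℝ} (hε : 0 < ε) (hε1 : ε ≤ 1) :
    ∃ t : ∀ d, Finset (QVec d), ∀ d, (∀ y ∈ t d, ‖y‖ = 1) ∧
      (∀ h : QVec d, ‖h‖ = 1 → ∃ y ∈ t d, ‖h - y‖ ≤ ε) ∧ ((t d).card : ℝ) ≤ ((3 / ε) ^ 4) ^ d := by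
  lift ε to NNReal using hε.le
  choose t ht hcover hcard using fun d => exists_isCover_card_le (mod_cast hε) (mod_cast hε1)
    (Metric.sphere_subset_closedBall (x := (0 : QVec d)))
  refine ⟨t, fun d => ⟨fun y hy => by simpa using ht d hy, fun h hh => ?_, ?_⟩⟩
  · obtain ⟨y, hy, hhy⟩ := hcover d (by simpa using hh : h ∈ Metric.sphere 0 1)
    refine ⟨y, hy, ?_⟩
    rw [← dist_eq_norm, dist_nndist]
    exact_mod_cast (edist_nndist h y).symm.trans_le hhy
  · rw [← pow_mul, ← finrank_qVec]
    exact hcard d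

theorem holdsWHP_forall_norm_eq_one {δ : ℝ} (hδ : 0 < δ) {G : ∀ d, QVec d → QVec d → QVec d → ℝ}
    (hG : ∀ d x, x ≠ 0 → IsInnerLipschitz (G d x)) :
    HoldsWHP.{u} fun d _ x A => ∀ h, ‖h‖ = 1 →
      |𝔼 k, G d x (A k) h ^ 2 - ∫ a, G d x a h ^ 2 ∂(halfGaussian (QVec d))| ≤ δ := by
  set ε := min (δ / 30) (1 / 4)
  have hε : 0 < ε := lt_min (by positivity) (by norm_num)
  have hε4 : ε ≤ 1 / 4 := min_le_right _ _
  have hεδ : ε ≤ δ / 30 := min_le_left _ _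
  obtain ⟨t, ht⟩ := exists_sphere_net hε (hε4.trans (by norm_num))
  have one_lt : 1 < (3 / ε) ^ 4 :=
    one_lt_pow₀ (by rw [lt_div_iff₀ hε]; linarith) (by norm_num)
  have on_net := (holdsWHP_forall_mem_finset.{u} one_lt (half_pos hδ) (fun d => (ht d).1)
    (fun d => (ht d).2.2) (F := fun d x a y => G d x a y ^ 2)
    (fun d x y hx => ((hG d x hx).measurable y).pow_const 2) (fun _ _ _ _ => sq_nonneg _)
    fun d x a y hx => (hG d x hx).sq_le a y)
  have gram_on_net := (holdsWHP_forall_mem_finset.{u} one_lt one_pos (fun d => (ht d).1)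
    (fun d => (ht d).2.2) (F := fun d _ a y => ‖qInner a y‖ ^ 2)
    (fun d x y _ => (measurable_qInner_left y).norm.pow_const 2) (fun _ _ _ _ => sq_nonneg _)
    fun _ _ _ _ _ => le_rfl)
  refine (on_net.and gram_on_net).mono fun d _ x A hx ⟨hA, hgram⟩ h hh => ?_
  have gram_le (h : QVec d) : 𝔼 k, ‖qInner (A k) h‖ ^ 2 ≤ 5 * ‖h‖ ^ 2 := by
    refine expect_norm_qInner_sq_le_of_net (t := t d) (fun h hh => ?_) (fun y hy => ?_) h
    · obtain ⟨y, hy, hhy⟩ := (ht d).2.1 h hh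
      exact ⟨y, hy, hhy.trans hε4⟩
    · have close := hgram y hy
      rw [integral_norm_qInner_sq, (ht d).1 y hy] at close
      linarith [(abs_le.1 close).2]
  obtain ⟨y, hy, hhy⟩ := (ht d).2.1 h hh
  have expect_close := (hG d x hx).abs_expect_sq_sub_le hε hh ((ht d).1 y hy) hhy gram_le
  have integral_close := (hG d x hx).abs_integral_sq_sub_le hε hh ((ht d).1 y hy) hhy
  have net_close := hA y hy
  rw [abs_le] at expect_close integral_close net_close ⊢
  constructor <;> linarith

theorem holdsWHP_of_homogeneous {δ : ℝ} (hδ : 0 < δ) {G : ∀ d, QVec d → QVec d → QVec d → ℝ}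
    (hG : ∀ d x, x ≠ 0 → IsInnerLipschitz (G d x))
    (hG_smul : ∀ d x a (r : ℝ) h, G d x a (r • h) ^ 2 = r ^ 2 * G d x a h ^ 2) :
    HoldsWHP.{u} fun d _ x A => ∀ h,
      |𝔼 k, G d x (A k) h ^ 2 - ∫ a, G d x a h ^ 2 ∂(halfGaussian (QVec d))| ≤ δ * ‖h‖ ^ 2 := by
  refine (holdsWHP_forall_norm_eq_one hδ hG).mono fun _ _ _ _ _ hA =>
    le_mul_norm_sq_of_homogeneous (fun r h => ?_) hA
  simp only [hG_smul, ← Finset.mul_expect, integral_const_mul, ← mul_sub, abs_mul, abs_sq]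

end UniformConcentration

/-! ### Expected quadratic forms -/

section Expectations

theorem map_inner_halfGaussian {E : Type*} [NormedAddCommGroup E] [InnerProductSpace ℝ E]
    [FiniteDimensional ℝ E] [MeasurableSpace E] [BorelSpace E] (s : E) :
    (halfGaussian E).map (inner ℝ s) = gaussianReal 0 (‖s‖₊ ^ 2 / 4) := by
  have := Measure.isProbabilityMeasure_map (μ := halfGaussian E)
    (f := fun z => inner ℝ s z) (by fun_prop)
  refine Measure.ext_of_charFun (funext fun t => ?_)
  rw [charFun_map_halfGaussian (g := fun t => t • s) (by fun_prop) (fun z t => ?_),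
    charFun_gaussianReal]
  · congr 1
    rw [norm_smul, Real.norm_eq_abs, ← Complex.ofReal_pow, mul_pow, sq_abs]
    push_cast
    ring
  · rw [real_inner_smul_right, real_inner_comm z s]
    simp

theorem map_inner_one_halfGaussian :
    (halfGaussian ℍ[ℝ]).map (inner ℝ 1) = gaussianReal 0 (1 / 4) := by
  simp [map_inner_halfGaussian]

theorem halfGaussian_quaternion_singleton_zero : halfGaussian ℍ[ℝ] {0} = 0 := by
  have preimage_null : halfGaussian ℍ[ℝ] (inner ℝ 1 ⁻¹' {0}) = 0 := by
    rw [← Measure.map_apply (by fun_prop) (measurableSet_singleton 0), map_inner_one_halfGaussian]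
    have := nullSingletonClass_gaussianReal (μ := 0) (v := 1 / 4) (by norm_num)
    exact measure_singleton 0
  exact measure_mono_null (by simp) preimage_null

theorem exists_halfGaussian_ball_le {ε : ℝ} (hε : 0 < ε) :
    ∃ τ : ℝ, 0 < τ ∧ τ ≤ 1 ∧ (halfGaussian ℍ[ℝ]).real (Metric.ball 0 τ) ≤ ε := by
  obtain ⟨U, hU, hU_open, hU_lt⟩ :=
    Set.exists_isOpen_lt_of_lt ({0} : Set ℍ[ℝ]) (ENNReal.ofReal ε) (μ := halfGaussian ℍ[ℝ])
      (by rw [halfGaussian_quaternion_singleton_zero]; exact ENNReal.ofReal_pos.2 hε)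
  obtain ⟨τ, hτ, hball⟩ := Metric.isOpen_iff.1 hU_open 0 (hU rfl)
  refine ⟨min τ 1, lt_min hτ one_pos, min_le_right _ _, ENNReal.toReal_le_of_le_ofReal hε.le ?_⟩
  exact (measure_mono ((Metric.ball_subset_ball (min_le_left _ _)).trans hball)).trans hU_lt.le

theorem not_ae_norm_sq_eq_one : ¬ ∀ᵐ q ∂(halfGaussian ℍ[ℝ]), ‖q‖ ^ 2 = 1 := by
  intro hae
  have Ioi_null : gaussianReal 0 (1 / 4) (Set.Ioi 1) = 0 := by
    rw [← map_inner_one_halfGaussian, Measure.map_apply (by fun_prop) measurableSet_Ioi]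
    refine measure_mono_null (t := {q | ¬ ‖q‖ ^ 2 = 1}) (fun q hq hnorm => ?_) hae
    have inner_le := real_inner_le_norm (1 : ℍ[ℝ]) q
    rw [norm_one, one_mul, (pow_eq_one_iff_of_nonneg (norm_nonneg q) two_ne_zero).1 hnorm]
      at inner_le
    exact inner_le.not_gt hq
  have volume_null := gaussianReal_absolutelyContinuous' 0 (v := 1 / 4) (by norm_num) Ioi_null
  simp at volume_null

variable {b : ℍ[ℝ] → ℝ}

theorem integrable_of_le_one (hb : Measurable b) (hb0 : ∀ q, 0 ≤ b q) (hb1 : ∀ q, b q ≤ 1) :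
    Integrable b (halfGaussian ℍ[ℝ]) :=
  (integrable_const (1 : ℝ)).mono' hb.aestronglyMeasurable
    (.of_forall fun q => by rw [Real.norm_eq_abs, abs_of_nonneg (hb0 q)]; exact hb1 q)

theorem integrable_mul_one_sub_norm_sq (hb : Measurable b) (hb0 : ∀ q, 0 ≤ b q)
    (hb1 : ∀ q, b q ≤ 1) : Integrable (fun q => b q * (1 - ‖q‖ ^ 2)) (halfGaussian ℍ[ℝ]) :=
  ((integrable_const 1).sub (integrable_norm_pow_halfGaussian 2)).bdd_mul hb.aestronglyMeasurable
    (.of_forall fun q => by rw [Real.norm_eq_abs, abs_of_nonneg (hb0 q)]; exact hb1 q)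

theorem integral_one_sub_norm_sq : ∫ q, (1 - ‖q‖ ^ 2) ∂(halfGaussian ℍ[ℝ]) = 0 := by
  rw [integral_sub (integrable_const 1) (integrable_norm_pow_halfGaussian 2),
    integral_norm_sq_quaternion]
  simp

theorem exp_neg_norm_sq_le_one (q : ℍ[ℝ]) : Real.exp (-‖q‖ ^ 2) ≤ 1 :=
  Real.exp_le_one_iff.2 (by simp)

/-- The gap `𝔼 (e^{-|q|²} (1 - |q|²))`, for a quaternionic Gaussian variable `q`, between the
eigenvalue of the expected initialization matrix at the signal and its other eigenvalue. -/
def spectralGap : ℝ := ∫ q, Real.exp (-‖q‖ ^ 2) * (1 - ‖q‖ ^ 2) ∂(halfGaussian ℍ[ℝ])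

theorem spectralGap_pos : 0 < spectralGap := by
  set f : ℍ[ℝ] → ℝ := fun q => (Real.exp (-‖q‖ ^ 2) - Real.exp (-1)) * (1 - ‖q‖ ^ 2) with hf
  have exp_integrable := integrable_mul_one_sub_norm_sq (b := fun q => Real.exp (-‖q‖ ^ 2))
    (by fun_prop) (fun q => (Real.exp_pos _).le) exp_neg_norm_sq_le_one
  have const_integrable :
      Integrable (fun q : ℍ[ℝ] => Real.exp (-1) * (1 - ‖q‖ ^ 2)) (halfGaussian ℍ[ℝ]) :=
    ((integrable_const 1).sub (integrable_norm_pow_halfGaussian 2)).const_mul _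
  have f_eq : f = fun q => Real.exp (-‖q‖ ^ 2) * (1 - ‖q‖ ^ 2) - Real.exp (-1) * (1 - ‖q‖ ^ 2) :=
    funext fun q => sub_mul _ _ _
  -- Since `1 - |q|²` has mean zero, `e⁻¹` may be subtracted from the weight, and then both factors
  -- change sign at `|q| = 1`.
  have gap_eq : spectralGap = ∫ q, f q ∂(halfGaussian ℍ[ℝ]) := by
    rw [f_eq, integral_sub exp_integrable const_integrable, integral_const_mul,
      integral_one_sub_norm_sq, mul_zero, sub_zero, spectralGap]
  have f_pos (q : ℍ[ℝ]) (hq : ‖q‖ ^ 2 ≠ 1) : 0 < f q := by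
    rcases lt_or_gt_of_ne hq with h | h
    · exact mul_pos (sub_pos.2 (Real.exp_lt_exp.2 (by linarith))) (by linarith)
    · exact mul_pos_of_neg_of_neg (sub_neg.2 (Real.exp_lt_exp.2 (by linarith))) (by linarith)
  have f_nonneg (q : ℍ[ℝ]) : 0 ≤ f q := by
    by_cases hq : ‖q‖ ^ 2 = 1
    · simp [hf, hq]
    · exact (f_pos q hq).le
  rw [gap_eq]
  refine (integral_nonneg f_nonneg).lt_of_ne fun integral_eq => not_ae_norm_sq_eq_one ?_
  have f_ae_eq := (integral_eq_zero_iff_of_nonneg f_nonneg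
    (f_eq ▸ exp_integrable.sub const_integrable)).1 integral_eq.symm
  filter_upwards [f_ae_eq] with q hq
  exact not_not.1 fun hne => (f_pos q hne).ne' hq

variable {d : ℕ} {x : QVec d}

theorem qInner_eq_add (a x h : QVec d) :
    qInner a h = qInner a x * qInner x h + qInner a (h - rightMul x (qInner x h)) := by
  rw [qInner_sub_right, qInner_rightMul_right]; abel

theorem qInner_sub_rightMul_qInner (hx : ‖x‖ = 1) (h : QVec d) :
    qInner x (h - rightMul x (qInner x h)) = 0 := by
  rw [qInner_sub_right, qInner_rightMul_right, qInner_self, hx]; simp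

theorem norm_sub_rightMul_qInner_sq (hx : ‖x‖ = 1) (h : QVec d) :
    ‖h - rightMul x (qInner x h)‖ ^ 2 = ‖h‖ ^ 2 - ‖qInner x h‖ ^ 2 := by
  rw [norm_sub_sq_real, norm_rightMul, hx, real_inner_comm, real_inner_rightMul_left,
    real_inner_self_eq_norm_sq]
  ring

theorem integral_norm_add_smul_sq (p : ℍ[ℝ]) (s : ℝ) :
    ∫ q, ‖p + s • q‖ ^ 2 ∂(halfGaussian ℍ[ℝ]) = ‖p‖ ^ 2 + s ^ 2 := by
  have expand (q : ℍ[ℝ]) : ‖p + s • q‖ ^ 2 = ‖p‖ ^ 2 + 2 * s * inner ℝ p q + s ^ 2 * ‖q‖ ^ 2 := by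
    rw [norm_add_sq_real, real_inner_smul_right, norm_smul, mul_pow, Real.norm_eq_abs, sq_abs]
    ring
  have cross_integrable := (integrable_inner_halfGaussian p).const_mul (2 * s)
  simp only [expand]
  rw [integral_add (by exact (integrable_const _).add cross_integrable)
      ((integrable_norm_pow_halfGaussian 2).const_mul _),
    integral_add (integrable_const _) cross_integrable, integral_const_mul, integral_const_mul,
    integral_inner_halfGaussian, integral_norm_sq_quaternion]
  simp

theorem integral_comp_qInner_mul_norm_qInner_sq_of_norm_eq_one (hb : Measurable b)
    (hb0 : ∀ q, 0 ≤ b q) (hb1 : ∀ q, b q ≤ 1) (hx : ‖x‖ = 1) (h : QVec d) :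
    ∫ a, b (qInner a x) * ‖qInner a h‖ ^ 2 ∂(halfGaussian (QVec d)) =
      (∫ q, b q ∂(halfGaussian ℍ[ℝ])) * ‖h‖ ^ 2
        - (∫ q, b q * (1 - ‖q‖ ^ 2) ∂(halfGaussian ℍ[ℝ])) * ‖qInner x h‖ ^ 2 := by
  set F : ℍ[ℝ] × ℍ[ℝ] → ℝ := fun p => b p.1 * ‖p.1 * qInner x h + p.2‖ ^ 2
  have hF : Measurable F :=
    (hb.comp measurable_fst).mul (Continuous.measurable (by fun_prop))
  have decompose (a : QVec d) : b (qInner a x) * ‖qInner a h‖ ^ 2 =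
      F (qInner a x, qInner a (h - rightMul x (qInner x h))) := by
    simp only [F, ← qInner_eq_add a x h]
  have h_int : Integrable (fun a => b (qInner a x) * ‖qInner a h‖ ^ 2)
      (halfGaussian (QVec d)) :=
    (integrable_norm_qInner_sq h).bdd_mul
      (hb.comp (measurable_qInner_left x)).aestronglyMeasurable
      (.of_forall fun a => by rw [Real.norm_eq_abs, abs_of_nonneg (hb0 _)]; exact hb1 _)
  simp only [decompose] at h_int ⊢
  rw [integral_comp_qInner_prod hF hx (qInner_sub_rightMul_qInner hx h) h_int]
  simp only [F, integral_const_mul, integral_norm_add_smul_sq, norm_sub_rightMul_qInner_sq hx h,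
    norm_mul, mul_pow]
  rw [← integral_mul_const, ← integral_mul_const, ← integral_sub
    ((integrable_of_le_one hb hb0 hb1).mul_const _)
    ((integrable_mul_one_sub_norm_sq hb hb0 hb1).mul_const _)]
  congr! 2 with q
  ring

theorem integral_comp_qInner_mul_norm_qInner_sq (hb : Measurable b) (hb0 : ∀ q, 0 ≤ b q)
    (hb1 : ∀ q, b q ≤ 1) (hx : x ≠ 0) (h : QVec d) :
    ∫ a, b (‖x‖⁻¹ • qInner a x) * ‖qInner a h‖ ^ 2 ∂(halfGaussian (QVec d)) =
      (∫ q, b q ∂(halfGaussian ℍ[ℝ])) * ‖h‖ ^ 2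
        - (∫ q, b q * (1 - ‖q‖ ^ 2) ∂(halfGaussian ℍ[ℝ])) * (‖qInner x h‖ / ‖x‖) ^ 2 := by
  have norm_eq_one : ‖‖x‖⁻¹ • x‖ = 1 := norm_smul_inv_norm (𝕜 := ℝ) hx
  have unit := integral_comp_qInner_mul_norm_qInner_sq_of_norm_eq_one hb hb0 hb1 norm_eq_one h
  simpa only [qInner_smul_right, qInner_smul_left, norm_smul, norm_inv, norm_norm,
    inv_mul_eq_div] using unit

theorem integral_sq_inner_add_smul_div_norm {u : ℍ[ℝ]} (hu : u ≠ 0) (r s : ℝ) :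
    ∫ q, (inner ℝ u (r • u + s • q) / ‖u‖) ^ 2 ∂(halfGaussian ℍ[ℝ]) =
      r ^ 2 * ‖u‖ ^ 2 + s ^ 2 / 4 := by
  have norm_ne : ‖u‖ ≠ 0 := norm_ne_zero_iff.2 hu
  have expand (q : ℍ[ℝ]) : (inner ℝ u (r • u + s • q) / ‖u‖) ^ 2 =
      r ^ 2 * ‖u‖ ^ 2 + 2 * r * s * inner ℝ u q + s ^ 2 / ‖u‖ ^ 2 * inner ℝ u q ^ 2 := by
    rw [inner_add_right, real_inner_smul_right, real_inner_smul_right, real_inner_self_eq_norm_sq]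
    field_simp
    ring
  have cross_integrable := (integrable_inner_halfGaussian u).const_mul (2 * r * s)
  simp only [expand]
  rw [integral_add (by exact (integrable_const _).add cross_integrable)
      ((integrable_inner_sq_halfGaussian u).const_mul _),
    integral_add (integrable_const _) cross_integrable, integral_const_mul (2 * r * s),
    integral_const_mul (s ^ 2 / ‖u‖ ^ 2), integral_inner_halfGaussian,
    integral_inner_sq_halfGaussian]
  simp only [integral_const, probReal_univ, one_smul, mul_zero, add_zero]
  field_simp

theorem integral_sq_inner_qInner_div_norm_of_norm_eq_one (hx : ‖x‖ = 1) {h : QVec d} {r : ℝ}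
    (hr : qInner x h = r) :
    ∫ a, (inner ℝ (qInner a x) (qInner a h) / ‖qInner a x‖) ^ 2 ∂(halfGaussian (QVec d)) =
      r ^ 2 + (‖h‖ ^ 2 - r ^ 2) / 4 := by
  set w := h - rightMul x (qInner x h)
  set F : ℍ[ℝ] × ℍ[ℝ] → ℝ := fun p => (inner ℝ p.1 (r • p.1 + p.2) / ‖p.1‖) ^ 2
  have hF : Measurable F :=
    ((Continuous.measurable (by fun_prop)).div measurable_fst.norm).pow_const 2
  have decompose (a : QVec d) : (inner ℝ (qInner a x) (qInner a h) / ‖qInner a x‖) ^ 2 =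
      F (qInner a x, qInner a w) := by
    simp only [F, w, qInner_eq_add a x h, hr, ← Quaternion.coe_commutes,
      Quaternion.coe_mul_eq_smul]
  have h_int : Integrable (fun a => F (qInner a x, qInner a w)) (halfGaussian (QVec d)) := by
    refine (integrable_norm_qInner_sq h).mono' (hF.comp ((measurable_qInner_left x).prodMk
      (measurable_qInner_left w))).aestronglyMeasurable (.of_forall fun a => ?_)
    rw [← decompose, norm_pow, Real.norm_eq_abs, sq_abs]
    exact sq_inner_div_norm_le _ _
  have norm_w_sq : ‖w‖ ^ 2 = ‖h‖ ^ 2 - r ^ 2 := by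
    rw [norm_sub_rightMul_qInner_sq hx, hr, Quaternion.norm_coe, Real.norm_eq_abs, sq_abs]
  have ae_ne_zero : ∀ᵐ u ∂(halfGaussian ℍ[ℝ]), u ≠ 0 := by
    rw [ae_iff]; simpa using halfGaussian_quaternion_singleton_zero
  simp only [decompose]
  rw [integral_comp_qInner_prod hF hx (qInner_sub_rightMul_qInner hx h) h_int]
  calc ∫ u, ∫ q, F (u, ‖w‖ • q) ∂(halfGaussian ℍ[ℝ]) ∂(halfGaussian ℍ[ℝ])
      = ∫ u, (r ^ 2 * ‖u‖ ^ 2 + ‖w‖ ^ 2 / 4) ∂(halfGaussian ℍ[ℝ]) :=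
        integral_congr_ae (ae_ne_zero.mono fun u hu =>
          integral_sq_inner_add_smul_div_norm hu r ‖w‖)
    _ = r ^ 2 + (‖h‖ ^ 2 - r ^ 2) / 4 := by
        rw [integral_add ((integrable_norm_pow_halfGaussian 2).const_mul _) (integrable_const _),
          integral_const_mul, integral_norm_sq_quaternion, norm_w_sq]
        simp

theorem le_integral_sq_inner_qInner_div_norm (hx : x ≠ 0) {h : QVec d}
    (hr : ∃ r : ℝ, qInner x h = r) : 1 / 4 * ‖h‖ ^ 2 ≤
      ∫ a, (inner ℝ (qInner a x) (qInner a h) / ‖qInner a x‖) ^ 2 ∂(halfGaussian (QVec d)) := by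
  obtain ⟨r, hr⟩ := hr
  have norm_pos : 0 < ‖x‖⁻¹ := inv_pos.2 (norm_pos_iff.2 hx)
  have unit := integral_sq_inner_qInner_div_norm_of_norm_eq_one (x := ‖x‖⁻¹ • x) (h := h)
    (r := ‖x‖⁻¹ * r) (norm_smul_inv_norm (𝕜 := ℝ) hx)
    (by rw [qInner_smul_left, hr, ← Quaternion.coe_smul, smul_eq_mul])
  simp only [qInner_smul_right, real_inner_smul_left, norm_smul, norm_inv, norm_norm,
    mul_div_mul_left _ _ norm_pos.ne'] at unit
  rw [unit]
  linarith [sq_nonneg (‖x‖⁻¹ * r)]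

theorem exists_integral_excess_le {ε : ℝ} (hε : 0 < ε) :
    ∃ T : ℝ, 0 < T ∧ ∀ {d : ℕ} {h : QVec d}, ‖h‖ = 1 →
      ∫ a, max (‖qInner a h‖ - T) 0 ^ 2 ∂(halfGaussian (QVec d)) ≤ ε := by
  set K := ∫ q, ‖q‖ ^ 4 ∂(halfGaussian ℍ[ℝ])
  have hK : 0 ≤ K := integral_nonneg fun q => by positivity
  obtain ⟨T, hT, hT_sq⟩ : ∃ T : ℝ, 0 < T ∧ T ^ 2 = (K + 1) / ε :=
    ⟨√((K + 1) / ε), by positivity, Real.sq_sqrt (by positivity)⟩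
  refine ⟨T, hT, fun {d h} hh => ?_⟩
  have excess_le (q : ℍ[ℝ]) : max (‖q‖ - T) 0 ^ 2 ≤ ‖q‖ ^ 4 / T ^ 2 := by
    rw [le_div_iff₀ (by positivity), ← mul_pow, show ‖q‖ ^ 4 = (‖q‖ ^ 2) ^ 2 by ring]
    gcongr
    rw [max_mul_of_nonneg _ _ hT.le, zero_mul]
    exact max_le (by nlinarith [sq_nonneg (‖q‖ - T)]) (by positivity)
  have fourth_integrable := (integrable_norm_pow_halfGaussian (E := ℍ[ℝ]) 4).div_const (T ^ 2)
  calc ∫ a, max (‖qInner a h‖ - T) 0 ^ 2 ∂(halfGaussian (QVec d))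
      = ∫ q, max (‖q‖ - T) 0 ^ 2 ∂(halfGaussian ℍ[ℝ]) := by
        rw [integral_comp_qInner (F := fun q => max (‖q‖ - T) 0 ^ 2) (by fun_prop), hh]
        simp only [one_smul]
    _ ≤ ∫ q, ‖q‖ ^ 4 / T ^ 2 ∂(halfGaussian ℍ[ℝ]) :=
        integral_mono_of_nonneg (.of_forall fun q => sq_nonneg _) fourth_integrable
          (.of_forall excess_le)
    _ = K / T ^ 2 := integral_div _ _
    _ ≤ ε := by
        rw [hT_sq, div_div_eq_mul_div, div_le_iff₀ (by linarith)]
        nlinarith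

end Expectations

/-! ### Regularity and spectral gap with high probability -/

section Events

universe u

variable {d : ℕ}

theorem isInnerLipschitz_mul_norm {w : QVec d → ℝ} (hw : Measurable w) (hw0 : ∀ a, 0 ≤ w a)
    (hw1 : ∀ a, w a ≤ 1) : IsInnerLipschitz fun a h => w a * ‖qInner a h‖ where
  measurable h := hw.mul (measurable_qInner_left h).norm
  map_zero a := by rw [qInner_zero_right, norm_zero, mul_zero]
  abs_sub_le a h y := by
    rw [← mul_sub, abs_mul, abs_of_nonneg (hw0 a), qInner_sub_right]
    exact (mul_le_of_le_one_left (abs_nonneg _) (hw1 a)).trans (abs_norm_sub_norm_le _ _)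

theorem isInnerLipschitz_inner_div_norm (x : QVec d) :
    IsInnerLipschitz fun a h => inner ℝ (qInner a x) (qInner a h) / ‖qInner a x‖ where
  measurable h := ((measurable_qInner_left x).inner (measurable_qInner_left h)).div
    (measurable_qInner_left x).norm
  map_zero a := by rw [qInner_zero_right, inner_zero_right, zero_div]
  abs_sub_le a h y := by
    rw [← sub_div, ← inner_sub_right, ← qInner_sub_right]
    exact abs_le_of_sq_le_sq (sq_inner_div_norm_le _ _) (norm_nonneg _)

theorem isInnerLipschitz_max_norm_sub {T : ℝ} (hT : 0 ≤ T) :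
    IsInnerLipschitz (d := d) fun a h => max (‖qInner a h‖ - T) 0 where
  measurable h := ((measurable_qInner_left h).norm.sub_const T).max measurable_const
  map_zero a := by simpa [qInner_zero_right] using hT
  abs_sub_le a h y := by
    rw [qInner_sub_right]
    refine (abs_max_sub_max_le_abs _ _ _).trans ?_
    rw [sub_sub_sub_cancel_right]
    exact abs_norm_sub_norm_le _ _

variable {b : ℍ[ℝ] → ℝ} {δ ε : ℝ}

theorem holdsWHP_weighted (hδ : 0 < δ) (hb : Measurable b) (hb0 : ∀ q, 0 ≤ b q)
    (hb1 : ∀ q, b q ≤ 1) :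
    HoldsWHP.{u} fun _ _ x A => ∀ h,
      |𝔼 k, b (‖x‖⁻¹ • qInner (A k) x) * ‖qInner (A k) h‖ ^ 2 -
        ((∫ q, b q ∂(halfGaussian ℍ[ℝ])) * ‖h‖ ^ 2 -
          (∫ q, b q * (1 - ‖q‖ ^ 2) ∂(halfGaussian ℍ[ℝ])) * (‖qInner x h‖ / ‖x‖) ^ 2)| ≤
        δ * ‖h‖ ^ 2 := by
  set G : ∀ d, QVec d → QVec d → QVec d → ℝ :=
    fun d x a h => √(b (‖x‖⁻¹ • qInner a x)) * ‖qInner a h‖ with hG_def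
  have G_sq (d : ℕ) (x a h : QVec d) :
      G d x a h ^ 2 = b (‖x‖⁻¹ • qInner a x) * ‖qInner a h‖ ^ 2 := by
    rw [hG_def, mul_pow, Real.sq_sqrt (hb0 _)]
  have concentration := holdsWHP_of_homogeneous.{u} hδ (G := G)
    (fun d x _ => isInnerLipschitz_mul_norm
      (hb.comp ((measurable_qInner_left x).const_smul ‖x‖⁻¹)).sqrt (fun a => Real.sqrt_nonneg _)
      fun a => Real.sqrt_le_one.2 (hb1 _))
    fun d x a r h => by
      rw [G_sq, G_sq, qInner_smul_right, norm_smul, mul_pow, Real.norm_eq_abs, sq_abs]; ring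
  refine concentration.mono fun d _ x A hx hA h => ?_
  simpa only [G_sq, integral_comp_qInner_mul_norm_qInner_sq hb hb0 hb1 hx] using hA h

theorem holdsWHP_gram (hδ : 0 < δ) :
    HoldsWHP.{u} fun _ _ _ A => ∀ h, |𝔼 k, ‖qInner (A k) h‖ ^ 2 - ‖h‖ ^ 2| ≤ δ * ‖h‖ ^ 2 := by
  refine (holdsWHP_weighted.{u} hδ (b := fun _ => 1) measurable_const (fun _ => zero_le_one)
    fun _ => le_rfl).mono fun _ _ _ _ _ hA h => ?_
  simpa [integral_one_sub_norm_sq] using hA h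

theorem holdsWHP_smallBall (hε : 0 < ε) :
    ∃ τ : ℝ, 0 < τ ∧ HoldsWHP.{u} fun _ _ x A => ∀ h,
      𝔼 k, (if ‖qInner (A k) x‖ < τ * ‖x‖ then ‖qInner (A k) h‖ ^ 2 else 0) ≤ ε * ‖h‖ ^ 2 := by
  obtain ⟨τ, hτ, hτ1, hball⟩ := exists_halfGaussian_ball_le (half_pos hε)
  refine ⟨τ, hτ, ?_⟩
  set b : ℍ[ℝ] → ℝ := (Metric.ball 0 τ).indicator 1 with hb_def
  have b_eq (q : ℍ[ℝ]) : b q = if ‖q‖ < τ then 1 else 0 := by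
    classical simp [hb_def, Set.indicator_apply]
  have hb0 (q : ℍ[ℝ]) : 0 ≤ b q := by rw [b_eq]; split_ifs <;> norm_num
  have hb1 (q : ℍ[ℝ]) : b q ≤ 1 := by rw [b_eq]; split_ifs <;> norm_num
  have integral_b : ∫ q, b q ∂(halfGaussian ℍ[ℝ]) = (halfGaussian ℍ[ℝ]).real (Metric.ball 0 τ) :=
    integral_indicator_one measurableSet_ball
  have gap_nonneg : 0 ≤ ∫ q, b q * (1 - ‖q‖ ^ 2) ∂(halfGaussian ℍ[ℝ]) := by
    refine integral_nonneg fun q => ?_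
    rw [b_eq]
    split_ifs with hq
    · have : ‖q‖ ^ 2 ≤ 1 := pow_le_one₀ (norm_nonneg q) (hq.le.trans hτ1)
      simpa using this
    · simp
  refine (holdsWHP_weighted.{u} (half_pos hε) (measurable_one.indicator measurableSet_ball) hb0
    hb1).mono fun d n x A hx hA h => ?_
  have term_eq (k : Fin n) :
      (if ‖qInner (A k) x‖ < τ * ‖x‖ then ‖qInner (A k) h‖ ^ 2 else 0) =
        b (‖x‖⁻¹ • qInner (A k) x) * ‖qInner (A k) h‖ ^ 2 := by
    simp only [b_eq, norm_smul, norm_inv, norm_norm, inv_mul_lt_iff₀ (norm_pos_iff.2 hx),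
      mul_comm τ, ite_mul, one_mul, zero_mul]
  simp only [term_eq]
  have close := (abs_le.1 (hA h)).2
  rw [integral_b] at close
  have ball_mul_le := mul_le_mul_of_nonneg_right hball (sq_nonneg ‖h‖)
  have gap_mul_nonneg := mul_nonneg gap_nonneg (sq_nonneg (‖qInner x h‖ / ‖x‖))
  linarith

theorem holdsWHP_curvature :
    HoldsWHP.{u} fun _ _ x A => ∀ h, (∃ r : ℝ, qInner x h = r) → 1 / 8 * ‖h‖ ^ 2 ≤
      𝔼 k, (inner ℝ (qInner (A k) x) (qInner (A k) h) / ‖qInner (A k) x‖) ^ 2 := by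
  have concentration := holdsWHP_of_homogeneous.{u} (δ := 1 / 8) (by norm_num)
    (G := fun d x a h => inner ℝ (qInner a x) (qInner a h) / ‖qInner a x‖)
    (fun d x _ => isInnerLipschitz_inner_div_norm x)
    fun d x a r h => by rw [qInner_smul_right, real_inner_smul_right, mul_div_assoc, mul_pow]
  refine concentration.mono fun d _ x A hx hA h hr => ?_
  linarith [(abs_le.1 (hA h)).1, le_integral_sq_inner_qInner_div_norm hx hr]

theorem ite_sq_le_max_sub_sq {T t : ℝ} (hT : 0 ≤ T) :
    (if 2 * T < t then t ^ 2 else 0) ≤ 4 * max (t - T) 0 ^ 2 := by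
  split_ifs with ht
  · rw [max_eq_left (by linarith)]
    nlinarith
  · positivity

theorem holdsWHP_tail (hε : 0 < ε) :
    ∃ T : ℝ, 0 < T ∧ HoldsWHP.{u} fun _ _ _ A => ∀ h,
      𝔼 k, (if T * ‖h‖ < ‖qInner (A k) h‖ then ‖qInner (A k) h‖ ^ 2 else 0) ≤ ε * ‖h‖ ^ 2 := by
  obtain ⟨T, hT, hexcess⟩ := exists_integral_excess_le (ε := ε / 8) (by positivity)
  refine ⟨2 * T, by positivity, ?_⟩
  refine (holdsWHP_forall_norm_eq_one.{u} (δ := ε / 8) (by positivity)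
    (G := fun d _ a h => max (‖qInner a h‖ - T) 0)
    fun d x _ => isInnerLipschitz_max_norm_sub hT.le).mono fun d n x A _ hA => ?_
  refine le_mul_norm_sq_of_homogeneous (fun r h => ?_) fun h hh => ?_
  · rcases eq_or_ne r 0 with rfl | hr
    · simp [qInner_zero_right]
    · simp only [qInner_smul_right, norm_smul, mul_left_comm (2 * T), mul_pow, Real.norm_eq_abs,
        sq_abs, mul_lt_mul_iff_right₀ (abs_pos.2 hr), Finset.mul_expect, mul_ite, mul_zero]
  · calc 𝔼 k, (if 2 * T * ‖h‖ < ‖qInner (A k) h‖ then ‖qInner (A k) h‖ ^ 2 else 0)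
        ≤ 4 * 𝔼 k, max (‖qInner (A k) h‖ - T) 0 ^ 2 := by
          rw [Finset.mul_expect, hh, mul_one]
          exact Finset.expect_le_expect fun k _ => ite_sq_le_max_sub_sq hT.le
      _ ≤ ε := by linarith [(abs_le.1 (hA h hh)).2, hexcess hh]

theorem exists_holdsWHP_isRegular (hε : 0 < ε) :
    ∃ τ T : ℝ, 0 < τ ∧ 0 < T ∧ HoldsWHP.{u} fun _ _ x A => IsRegular A x τ T ε := by
  obtain ⟨τ, hτ, smallBall⟩ := holdsWHP_smallBall.{u} hε
  obtain ⟨T, hT, tail⟩ := holdsWHP_tail.{u} hε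
  refine ⟨τ, T, hτ, hT, (((holdsWHP_gram.{u} one_pos).and holdsWHP_curvature.{u}).and
    (smallBall.and tail)).mono fun _ _ _ _ _ ⟨⟨gram, curvature_ge⟩, small_le, tail_le⟩ => ?_⟩
  exact ⟨fun h => by linarith [(abs_le.1 (gram h)).2], curvature_ge, small_le, tail_le⟩

theorem holdsWHP_hasSpectralGap (hδ : 0 < δ) :
    HoldsWHP.{u} fun _ _ x A =>
      HasSpectralGap A x spectralGap (∫ q, Real.exp (-‖q‖ ^ 2) ∂(halfGaussian ℍ[ℝ])) δ := by
  refine ((holdsWHP_gram.{u} hδ).and (holdsWHP_weighted.{u} hδ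
    (b := fun q => Real.exp (-‖q‖ ^ 2)) (by fun_prop) (fun q => (Real.exp_pos _).le)
    exp_neg_norm_sq_le_one)).mono fun _ _ _ _ _ ⟨gram, attenuated⟩ => ⟨gram, fun h => ?_⟩
  simpa only [spectralGap, norm_smul, norm_inv, norm_norm, inv_mul_eq_div] using attenuated h

variable {σ ρ : ℝ}

theorem exists_holdsWHP_lrc (hσ : 0 < σ) :
    ∃ ρ : ℝ, 0 < ρ ∧ ρ < 1 ∧ HoldsWHP.{u} fun _ _ x A =>
      LRC (gradient A (amplitudes A x) (perturbation σ (amplitudes A x))) x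
        (1 / (128 * (4 + σ))) (1 / (16 * (4 + σ))) ρ := by
  obtain ⟨τ, T, hτ, hT, regular⟩ :=
    exists_holdsWHP_isRegular.{u} (ε := 1 / (256 * (4 + σ))) (by positivity)
  set δ := min 1 (σ / (384 * (4 + σ)))
  have hδ : 0 < δ := by positivity
  refine ⟨min (1 / 2) (δ * τ / T), by positivity, (min_le_left _ _).trans_lt one_half_lt_one,
    regular.mono fun _ _ _ _ _ hA =>
      hA.lrc hσ hδ.le (min_le_left _ _) ?_ (le_of_eq ?_) hT.le ?_⟩
  · calc 3 * δ / σ * 2 ≤ 3 * (σ / (384 * (4 + σ))) / σ * 2 := by gcongr; exact min_le_right _ _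
      _ = 1 / (64 * (4 + σ)) := by field_simp; norm_num
  · field_simp; norm_num
  · rw [mul_comm, ← le_div_iff₀ hT]
    exact min_le_right _ _

theorem holdsWHP_phaseDist_initial_le (γ : ℝ) (hρ : 0 < ρ) :
    HoldsWHP.{u} fun _ _ x A => ∀ v, IsLeadingEigenvector (initMatrix A (amplitudes A x) γ) v →
      phaseDist (normEstimate (amplitudes A x) • v) x ≤ ρ * ‖x‖ := by
  have gap_pos := spectralGap_pos
  have factor_pos : 0 < 1 + (40 + 8 * |γ|) / spectralGap := by positivity
  set δ := min (1 / 2) (ρ ^ 2 / (1 + (40 + 8 * |γ|) / spectralGap))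
  refine (holdsWHP_hasSpectralGap.{u} (δ := δ) (by positivity)).mono
    fun _ _ _ _ hx hA v hv => ?_
  exact hA.phaseDist_initial_le gap_pos (min_le_left _ _) hρ.le
    ((le_div_iff₀ factor_pos).1 (min_le_right _ _)) hx hv

end Events

end QPAF

end

theorem mainTheorem3 (σ : ℝ) (hσ : 0 < σ) (γ : ℝ) :
    -- the search direction is twice the generalized `ℍℝ` gradient of the objective
    (∀ (d n : ℕ) (A : Fin n → QPAF.QVec d) (x z : QPAF.QVec d),
      DifferentiableAt ℝ (QPAF.loss A (QPAF.amplitudes A x)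
        (QPAF.perturbation σ (QPAF.amplitudes A x))) z ∧
      QPAF.gradient A (QPAF.amplitudes A x) (QPAF.perturbation σ (QPAF.amplitudes A x)) z =
        (2 : ℝ) • QPAF.ghrGradient (QPAF.loss A (QPAF.amplitudes A x)
          (QPAF.perturbation σ (QPAF.amplitudes A x))) z) ∧
    -- local regularity, accuracy of the initial guess, and linear convergence
    ∃ C c₁ c₂ μ lam ρ : ℝ, 0 < C ∧ 0 < c₁ ∧ 0 < c₂ ∧ 0 < μ ∧ 0 < lam ∧ lam * μ < 1 ∧
      0 < ρ ∧ ρ < 1 ∧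
      ∀ (d n : ℕ) (x : QPAF.QVec d), x ≠ 0 → C * (d : ℝ) ≤ (n : ℝ) →
      ∀ (Ω : Type*) [MeasurableSpace Ω] (P : MeasureTheory.Measure Ω)
        [MeasureTheory.IsProbabilityMeasure P] (α : Fin n → Ω → QPAF.QVec d),
        QPAF.IsQuaternionGaussian P α →
        P {ω | ¬ (
          QPAF.LRC (QPAF.gradient (fun k => α k ω) (QPAF.amplitudes (fun k => α k ω) x)
            (QPAF.perturbation σ (QPAF.amplitudes (fun k => α k ω) x))) x μ lam ρ ∧
          (∃ v, QPAF.IsLeadingEigenvector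
            (QPAF.initMatrix (fun k => α k ω) (QPAF.amplitudes (fun k => α k ω) x) γ) v) ∧
          ∀ v : QPAF.QVec d, QPAF.IsLeadingEigenvector
              (QPAF.initMatrix (fun k => α k ω) (QPAF.amplitudes (fun k => α k ω) x) γ) v →
            ∀ z₀ : QPAF.QVec d,
              z₀ = QPAF.normEstimate (QPAF.amplitudes (fun k => α k ω) x) • v →
            QPAF.phaseDist z₀ x ≤ ρ * ‖x‖ ∧
            ∀ η : ℝ, 0 < η → η ≤ μ → ∀ t : ℕ,
              QPAF.phaseDist (QPAF.iterates (fun k => α k ω)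
                  (QPAF.amplitudes (fun k => α k ω) x) σ η z₀ t) x ^ 2
                ≤ (1 - lam * η) ^ t * QPAF.phaseDist z₀ x ^ 2)}
          ≤ ENNReal.ofReal (c₁ * Real.exp (-(c₂ * (n : ℝ)))) := by
  refine ⟨fun d n A x z =>
    ⟨(QPAF.hasFDerivAt_loss A (QPAF.eq_zero_of_perturbation_eq_zero hσ _) z).differentiableAt,
      QPAF.gradient_eq_two_smul_ghrGradient A (QPAF.eq_zero_of_perturbation_eq_zero hσ _) z⟩, ?_⟩
  obtain ⟨ρ, hρ, hρ1, lrc⟩ := QPAF.exists_holdsWHP_lrc hσ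
  obtain ⟨C, c₁, c₂, hC, hc₁, hc₂, whp⟩ := lrc.and (QPAF.holdsWHP_phaseDist_initial_le γ hρ)
  have lam_mul_mu_lt_one : 1 / (16 * (4 + σ)) * (1 / (128 * (4 + σ))) < 1 :=
    mul_lt_one_of_nonneg_of_lt_one_left (by positivity)
      ((div_lt_one (by positivity)).2 (by linarith)) ((div_le_one (by positivity)).2 (by linarith))
  refine ⟨C, c₁, c₂, 1 / (128 * (4 + σ)), 1 / (16 * (4 + σ)), ρ, hC, hc₁, hc₂, by positivity,
    by positivity, lam_mul_mu_lt_one, hρ, hρ1, fun d n x hx hn Ω _ P _ α hα =>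
      (measure_mono (Set.ofPred_subset_ofPred.2 fun ω => mt ?_)).trans (whp d n x hx hn Ω P α hα)⟩
  rintro ⟨hLRC, initial_le⟩
  have : Nontrivial (QPAF.QVec d) := ⟨x, 0, hx⟩
  refine ⟨hLRC, QPAF.exists_isLeadingEigenvector _ _ γ, ?_⟩
  rintro v hv _ rfl
  exact ⟨initial_le v hv, fun η hη hημ t => hLRC.phaseDist_iterates_sq_le (by positivity)
    lam_mul_mu_lt_one hη hημ (initial_le v hv) t⟩
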